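/- Theorem 4.2. Consider the following uniform machine model: a deterministic random access machine with natural-number registers and finitely many named arrays (dynamically addressed), unit cost per instruction, with constants, addition, truncated subtraction, comparisons, array reads and writes, branching and looping, an instruction that draws a fresh sample, and an instruction that reads one coordinate of the current sample. There are a program and an absolute constant $C>0$ such that the following holds. Let $n\ge 1$, let $\Sigma=\{0,\dots,|\Sigma|-1\}$ be an alphabet with $|\Sigma|\ge 2$, let $d\ge 0$, let $G$ be a directed acyclic graph on $n$ vertices with in-degree at most $d$, and let $0<\varepsilon\le 1$ and $0<\delta<1$. The program is given $n,|\Sigma|,d$, the in-degrees and the sorted parent lists of $G$, and, as its accuracy and confidence parameters, any rational numbers $e\in[\varepsilon/2,\varepsilon]$ and $f\in[\delta/2,\delta]$ in lowest terms (for rational $\varepsilon,\delta$ one may take $e=\varepsilon$, $f=\delta$). There is a number $m$, depending only on this input, with $$m\le C\,|\Sigma|^{d+1}\,n\,\log\!\big(|\Sigma|^{d+1}n\big)\,\varepsilon^{-2}\,\log\tfrac{2}{\delta},$$ such that on every sequence of samples from $\Sigma^n$ the program draws exactly $m$ samples, halts after at most $C\,|\Sigma|^{d+1}\,m\,n$ steps,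 and outputs a Bayesian network $Q$ on $G$, written in memory as the tables of its conditional probabilities (numerators and positive denominators) for each vertex and each assignment to the parents of that vertex. If the samples are independent draws from a Bayesian network distribution $P$ on $G$, then $$\Pr\big[d_{\mathrm{TV}}(P,Q)\le\varepsilon\big]\ge 1-\delta .$$ Here a distribution of $(X_1,\dots,X_n)\in\Sigma^n$ is a Bayesian network on $G$ if every $X_i$ is conditionally independent of its non-descendants given its parents, and $d_{\mathrm{TV}}(P,Q)=\frac12\sum_x|P(x)-Q(x)|$. -/

import Mathlib

open MeasureTheory

/-! ### Directed graphs and Bayesian networks -/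

namespace BayesLearn

/-- A directed graph (`G.Adj j i` means that there is an edge `j → i`) is acyclic. -/
def IsDAG {V : Type*} (G : Digraph V) : Prop :=
  ∀ v, ¬ Relation.TransGen G.Adj v v

open Classical in
/-- The parents of `i`, listed in increasing order. -/
noncomputable def parentList {n : ℕ} (G : Digraph (Fin n)) (i : Fin n) : List (Fin n) :=
  (List.finRange n).filter (fun j => G.Adj j i)

open Classical in
/-- The set of parents of `i`. -/
noncomputable def parents {n : ℕ} (G : Digraph (Fin n)) (i : Fin n) : Finset (Fin n) :=
  Finset.univ.filter (fun j => G.Adj j i)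

open Classical in
/-- The non-descendants of `i`: all vertices other than `i` that no directed path from `i`
reaches. -/
noncomputable def nonDescendants {n : ℕ} (G : Digraph (Fin n)) (i : Fin n) : Finset (Fin n) :=
  Finset.univ.filter (fun j => j ≠ i ∧ ¬ Relation.TransGen G.Adj i j)

/-- The marginal probability `Pr_{X ∼ P}[X_S = x_S]`. -/
noncomputable def marg {n k : ℕ} (P : PMF (Fin n → Fin k)) (S : Finset (Fin n))
    (x : Fin n → Fin k) : ℝ :=
  ∑ y : Fin n → Fin k, if ∀ j ∈ S, y j = x j then (P y).toReal else 0

/-- `P` is a Bayesian network on `G`: for every vertex `i`, the variable `X_i` is conditionally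
independent of `X_{nonDescendants i}` given `X_{parents i}`. For discrete variables, `A` and `B`
are conditionally independent given `C` when
`Pr[A = a, B = b, C = c] * Pr[C = c] = Pr[A = a, C = c] * Pr[B = b, C = c]` for all values. -/
def IsBayesNet {n k : ℕ} (G : Digraph (Fin n)) (P : PMF (Fin n → Fin k)) : Prop :=
  ∀ (i : Fin n) (x : Fin n → Fin k),
    marg P ({i} ∪ nonDescendants G i ∪ parents G i) x * marg P (parents G i) x =
      marg P ({i} ∪ parents G i) x * marg P (nonDescendants G i ∪ parents G i) x

/-- Total variation distance of two distributions on a finite set. -/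
noncomputable def tvDist {α : Type*} [Fintype α] (P Q : PMF α) : ℝ :=
  (1 / 2) * ∑ x, |(P x).toReal - (Q x).toReal|

/-! ### A unit-cost random access machine with sample access

Programs are structured programs over registers and finitely many (dynamically addressed) arrays of
natural numbers. The only arithmetic operations are addition and truncated subtraction, so that
unit cost per instruction is a realistic measure of time. -/

/-- Programs. Registers and arrays are named by numerals; array cells are addressed through the
content of a register. -/
inductive Prog : Type
  /-- do nothing -/
  | skip : Prog
  /-- `R[r] := c` -/
  | const (r c : ℕ) : Prog
  /-- `R[r] := R[a] + R[b]` -/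
  | add (r a b : ℕ) : Prog
  /-- `R[r] := max (R[a] - R[b]) 0` -/
  | sub (r a b : ℕ) : Prog
  /-- `R[r] := A_t[R[a]]` -/
  | load (r t a : ℕ) : Prog
  /-- `A_t[R[a]] := R[r]` -/
  | store (t a r : ℕ) : Prog
  /-- request a fresh sample, which replaces the current one -/
  | draw : Prog
  /-- `R[r] :=` coordinate number `R[a]` of the current sample -/
  | read (r a : ℕ) : Prog
  /-- first `p`, then `q` -/
  | seq (p q : Prog) : Prog
  /-- if `R[a] < R[b]` then `p` else `q` -/
  | ite (a b : ℕ) (p q : Prog) : Prog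
  /-- while `R[a] < R[b]` do `p` -/
  | loop (a b : ℕ) (p : Prog) : Prog

/-- A machine configuration: registers, arrays, and the number of samples drawn so far. -/
structure Config where
  reg : ℕ → ℕ
  arr : ℕ → ℕ → ℕ
  draws : ℕ

/-- Write `v` into register `r`. -/
def Config.setReg (s : Config) (r v : ℕ) : Config :=
  { s with reg := Function.update s.reg r v }

/-- Write `v` into cell `c` of array `t`. -/
def Config.setArr (s : Config) (t c v : ℕ) : Config :=
  { s with arr := Function.update s.arr t (Function.update (s.arr t) c v) }

/-- `Exec ω p s s' T`: on the stream of samples `ω` (`ω t j` is coordinate `j` of sample number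
`t`), the program `p` started in `s` halts in `s'` after exactly `T` steps. Every instruction and
every test costs one step. -/
inductive Exec (ω : ℕ → ℕ → ℕ) : Prog → Config → Config → ℕ → Prop
  | skip (s : Config) : Exec ω Prog.skip s s 1
  | const (s : Config) (r c : ℕ) : Exec ω (Prog.const r c) s (s.setReg r c) 1
  | add (s : Config) (r a b : ℕ) :
      Exec ω (Prog.add r a b) s (s.setReg r (s.reg a + s.reg b)) 1
  | sub (s : Config) (r a b : ℕ) :
      Exec ω (Prog.sub r a b) s (s.setReg r (s.reg a - s.reg b)) 1
  | load (s : Config) (r t a : ℕ) :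
      Exec ω (Prog.load r t a) s (s.setReg r (s.arr t (s.reg a))) 1
  | store (s : Config) (t a r : ℕ) :
      Exec ω (Prog.store t a r) s (s.setArr t (s.reg a) (s.reg r)) 1
  | draw (s : Config) : Exec ω Prog.draw s { s with draws := s.draws + 1 } 1
  | read (s : Config) (r a : ℕ) :
      Exec ω (Prog.read r a) s
        (s.setReg r (if s.draws = 0 then 0 else ω (s.draws - 1) (s.reg a))) 1
  | seq {p q : Prog} {s s' s'' : Config} {T T' : ℕ} :
      Exec ω p s s' T → Exec ω q s' s'' T' → Exec ω (Prog.seq p q) s s'' (T + T')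
  | ite_true {a b : ℕ} {p q : Prog} {s s' : Config} {T : ℕ} :
      s.reg a < s.reg b → Exec ω p s s' T → Exec ω (Prog.ite a b p q) s s' (T + 1)
  | ite_false {a b : ℕ} {p q : Prog} {s s' : Config} {T : ℕ} :
      ¬ s.reg a < s.reg b → Exec ω q s s' T → Exec ω (Prog.ite a b p q) s s' (T + 1)
  | loop_done {a b : ℕ} {p : Prog} {s : Config} :
      ¬ s.reg a < s.reg b → Exec ω (Prog.loop a b p) s s 1
  | loop_step {a b : ℕ} {p : Prog} {s s' s'' : Config} {T T' : ℕ} :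
      s.reg a < s.reg b → Exec ω p s s' T → Exec ω (Prog.loop a b p) s' s'' T' →
        Exec ω (Prog.loop a b p) s s'' (T + T' + 1)

/-- The machine is deterministic: the final configuration and the running time are determined by
the program, the initial configuration and the samples. -/
theorem Exec.unique {ω : ℕ → ℕ → ℕ} {p : Prog} {s s₁ s₂ : Config} {T₁ T₂ : ℕ}
    (h₁ : Exec ω p s s₁ T₁) (h₂ : Exec ω p s s₂ T₂) : s₁ = s₂ ∧ T₁ = T₂ := by
  induction h₁ generalizing s₂ T₂ with
  | skip | const | add | sub | load | store | draw | read =>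
    cases h₂; exact ⟨rfl, rfl⟩
  | seq _ _ ih ih' =>
    cases h₂ with
    | seq g g' =>
      obtain ⟨rfl, rfl⟩ := ih g
      obtain ⟨rfl, rfl⟩ := ih' g'
      exact ⟨rfl, rfl⟩
  | ite_true h _ ih =>
    cases h₂ with
    | ite_true _ g => obtain ⟨rfl, rfl⟩ := ih g; exact ⟨rfl, rfl⟩
    | ite_false h' _ => exact absurd h h'
  | ite_false h _ ih =>
    cases h₂ with
    | ite_true h' _ => exact absurd h' h
    | ite_false _ g => obtain ⟨rfl, rfl⟩ := ih g; exact ⟨rfl, rfl⟩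
  | loop_done h =>
    cases h₂ with
    | loop_done _ => exact ⟨rfl, rfl⟩
    | loop_step h' _ _ => exact absurd h' h
  | loop_step h _ _ ih ih' =>
    cases h₂ with
    | loop_done h' => exact absurd h h'
    | loop_step _ g g' =>
      obtain ⟨rfl, rfl⟩ := ih g
      obtain ⟨rfl, rfl⟩ := ih' g'
      exact ⟨rfl, rfl⟩

/-! ### Input, samples and output -/

/-- The initial configuration. Registers `0, …, 6` hold `n`, `k = |Σ|`, `d` and the numerators and
denominators of the accuracy `e` and the failure probability `f`; array `0` holds the in-degrees,
array `1` holds the adjacency lists of `G` (the `j`-th parent of vertex `i`, in increasing order,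
is in cell `i * d + j`). Everything else is `0`. -/
noncomputable def initConfig {n : ℕ} (k d : ℕ) (G : Digraph (Fin n)) (e f : ℚ) : Config where
  reg := fun r => [n, k, d, e.num.toNat, e.den, f.num.toNat, f.den].getD r 0
  arr := fun t c =>
    if t = 0 then
      if h : c < n then (parentList G ⟨c, h⟩).length else 0
    else if t = 1 then
      if h : c / d < n then
        ((parentList G ⟨c / d, h⟩).map (fun v : Fin n => (v : ℕ))).getD (c % d) 0
      else 0
    else 0
  draws := 0

/-- A sequence of samples from `Σⁿ` (with `Σ = {0, …, k-1}`) as the machine sees it. -/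
def codeStream {n k : ℕ} (ω : ℕ → Fin n → Fin k) : ℕ → ℕ → ℕ :=
  fun t j => if h : j < n then (ω t ⟨j, h⟩ : ℕ) else 0

/-- The number (in base `k`, first parent least significant) that codes the values which `x` gives
to the parents of `i`. It is less than `k ^ (in-degree of i)`. -/
noncomputable def parentCode {n k : ℕ} (G : Digraph (Fin n)) (i : Fin n) (x : Fin n → Fin k) : ℕ :=
  Nat.ofDigits k ((parentList G i).map (fun j : Fin n => (x j : ℕ)))

/-- The numerator in the table entry for `Q(X_i = σ | parents of i have code a)`: cell
`(i * k ^ d + a) * k + σ` of array `2`. -/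
def outNum (k d : ℕ) (s : Config) (i a σ : ℕ) : ℕ := s.arr 2 ((i * k ^ d + a) * k + σ)

/-- The common denominator of the table entries `Q(X_i = · | parents of i have code a)`: cell
`i * k ^ d + a` of array `3`. -/
def outDen (k d : ℕ) (s : Config) (i a : ℕ) : ℕ := s.arr 3 (i * k ^ d + a)

/-- The memory contains conditional probability tables, and `Q` is the distribution on `Σⁿ`
with these conditional probabilities. -/
def Encodes {n k : ℕ} (d : ℕ) (G : Digraph (Fin n)) (s : Config) (Q : PMF (Fin n → Fin k)) :
    Prop :=
  (∀ (i : Fin n) (x : Fin n → Fin k),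
    0 < outDen k d s i (parentCode G i x) ∧
      ∑ σ : Fin k, outNum k d s i (parentCode G i x) σ = outDen k d s i (parentCode G i x)) ∧
  ∀ x : Fin n → Fin k,
    (Q x).toReal =
      ∏ i : Fin n, (outNum k d s i (parentCode G i x) (x i) : ℝ) /
        (outDen k d s i (parentCode G i x) : ℝ)

/-- The law of an infinite sequence of independent samples from `P`. -/
noncomputable def sampleLaw {n k : ℕ} (P : PMF (Fin n → Fin k)) :
    Measure (ℕ → Fin n → Fin k) :=
  Measure.infinitePi (fun _ : ℕ => P.toMeasure)

end BayesLearn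

namespace BayesLearn

/-! ### Factorizations over directed acyclic graphs -/

/-! The learner counts, for every vertex i, parent code a and symbol σ, how often the family of i
shows (a, σ), adds the pseudo-count 3L to each count and normalizes. Smoothing makes all entries of
Q positive, so the relative entropy of P from Q is finite for every sample sequence.

Statistics. A Bayesian network is the product of its conditional probabilities
(`IsBayesNet.eq_prod`), and Q is such a product by construction, hence itself a Bayesian network
(`isBayesNet_of_factor`). So relative entropy splits over the vertices, and log t ≤ t - 1 bounds
each summand by a weighted sum of χ²-divergences, one per parent assignment (`sum_mul_log_prod_le`).
By `sq_half_sum_abs_sub_le` the total dominates the squared total variation distance. If every count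
is within its Bernstein deviation, the χ²-divergence at a parent assignment of probability π > 0 is
at most 312kL/(mπ) (`smoothed_chiSq_le`). Its weight is π, which cancels: a rare parent assignment
costs no more than a frequent one, and no lower bound on probabilities is needed. With N = k^(d+1) n
this gives a squared distance of at most 312NL/m (`AllClose.tvDist_sq_le`). A Chernoff bound and a
union bound make the counts fail with probability at most 4N exp(-L) (`sampleLaw_not_allClose_le`).

Parameters. A = ⌈1/e⌉, L is the least exponent with 4N ≤ f 2^L, and m = 312 N L A².

Machine. `Runs` is a total-correctness triple with a time bound. A product is computed by repeated
addition, at a cost linear in the second factor, and A and L by loops whose length is the result.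
Hence the running time does not depend on the size of the numerators and denominators of e and f.
Table cells of different (vertex, code, symbol) are distinct, so the final memory holds exactly the
smoothed counts (`exists_exec_learnProg`). -/

/-- A set of vertices that contains the parents of its elements. -/
def ParentClosed {V : Type*} (G : Digraph V) (S : Finset V) : Prop :=
  ∀ i ∈ S, ∀ j, G.Adj j i → j ∈ S

/-- `F x` depends only on the coordinates of `x` in `S`. -/
def DependsOnlyOn {n k : ℕ} {β : Type*} (F : (Fin n → Fin k) → β) (S : Finset (Fin n)) : Prop :=
  ∀ x y, (∀ j ∈ S, x j = y j) → F x = F y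

/-- `f i` is a conditional probability of coordinate `i` given the parents of `i`. -/
structure IsLocalFactor {n k : ℕ} (G : Digraph (Fin n)) (f : Fin n → (Fin n → Fin k) → ℝ) :
    Prop where
  congr : ∀ i x y, x i = y i → (∀ j, G.Adj j i → x j = y j) → f i x = f i y
  sum_eq_one : ∀ i x, ∑ σ, f i (Function.update x i σ) = 1

section

variable {n k : ℕ} {G : Digraph (Fin n)}

theorem mem_parents {i j : Fin n} : j ∈ parents G i ↔ G.Adj j i := by
  simp [parents]

theorem mem_nonDescendants {i j : Fin n} :
    j ∈ nonDescendants G i ↔ j ≠ i ∧ ¬ Relation.TransGen G.Adj i j := by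
  simp [nonDescendants]

theorem mem_parentList {i j : Fin n} : j ∈ parentList G i ↔ G.Adj j i := by
  simp [parentList]

theorem IsDAG.not_adj_self (hG : IsDAG G) (i : Fin n) : ¬ G.Adj i i :=
  fun h => hG i (.single h)

theorem IsDAG.parents_subset (hG : IsDAG G) (i : Fin n) : parents G i ⊆ nonDescendants G i := by
  intro j hj
  rw [mem_parents] at hj
  rw [mem_nonDescendants]
  exact ⟨fun h => hG.not_adj_self i (h ▸ hj), fun h => hG i (h.tail hj)⟩

theorem parentClosed_nonDescendants (i : Fin n) :
    ParentClosed G (nonDescendants G i) := by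
  intro a ha b hb
  rw [mem_nonDescendants] at ha ⊢
  exact ⟨fun h => ha.2 (.single (h ▸ hb)), fun h => ha.2 (h.tail hb)⟩

theorem IsDAG.wellFounded (hG : IsDAG G) : WellFounded (Relation.TransGen G.Adj) :=
  haveI : Std.Irrefl (Relation.TransGen G.Adj) := ⟨hG⟩
  Finite.wellFounded_of_trans_of_irrefl _

theorem IsDAG.wellFounded_swap (hG : IsDAG G) :
    WellFounded (Function.swap (Relation.TransGen G.Adj)) :=
  haveI : Std.Irrefl (Function.swap (Relation.TransGen G.Adj)) := ⟨hG⟩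
  haveI : IsTrans _ (Function.swap (Relation.TransGen G.Adj)) := ⟨fun _ _ _ h g => g.trans h⟩
  Finite.wellFounded_of_trans_of_irrefl _

/-- Summation over all assignments, one coordinate at a time. -/
theorem sum_sum_update (i : Fin n) (g : (Fin n → Fin k) → ℝ) :
    ∑ x, ∑ σ, g (Function.update x i σ) = k * ∑ x, g x := by
  -- The spare symbol trades places with coordinate i: an involution of the pairs (x, σ).
  let φ : (Fin n → Fin k) × Fin k → (Fin n → Fin k) × Fin k :=
    fun p => (Function.update p.1 i p.2, p.1 i)
  have hφ : Function.Involutive φ := by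
    rintro ⟨x, σ⟩
    simp [φ]
  rw [← Fintype.sum_prod_type' (f := fun x σ => g (Function.update x i σ))]
  have := Equiv.sum_comp hφ.toPerm (fun p : (Fin n → Fin k) × Fin k => g p.1)
  simp only [Function.Involutive.coe_toPerm, φ] at this
  rw [this, Fintype.sum_prod_type]
  simp [Finset.mul_sum]

variable {f : Fin n → (Fin n → Fin k) → ℝ}

theorem IsLocalFactor.update_of_not_adj (hf : IsLocalFactor G f) {i j : Fin n} (hij : j ≠ i)
    (h : ¬ G.Adj i j) (x : Fin n → Fin k) (σ : Fin k) : f j (Function.update x i σ) = f j x := by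
  refine hf.congr j _ _ (Function.update_of_ne hij _ _) fun l hl => ?_
  exact Function.update_of_ne (by rintro rfl; exact h hl) _ _

theorem IsLocalFactor.prod_update (hf : IsLocalFactor G f) {S : Finset (Fin n)}
    (hS : ParentClosed G S) {i : Fin n} (hi : i ∉ S) (x : Fin n → Fin k) (σ : Fin k) :
    ∏ j ∈ S, f j (Function.update x i σ) = ∏ j ∈ S, f j x :=
  Finset.prod_congr rfl fun j hj =>
    hf.update_of_not_adj (by rintro rfl; exact hi hj) (fun h => hi (hS j hj i h)) x σ

theorem DependsOnlyOn.update {β : Type*} {F : (Fin n → Fin k) → β} {S : Finset (Fin n)}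
    (hF : DependsOnlyOn F S) {i : Fin n} (hi : i ∉ S) (x : Fin n → Fin k) (σ : Fin k) :
    F (Function.update x i σ) = F x :=
  hF _ _ fun j hj => Function.update_of_ne (fun e => hi (by rwa [← e])) _ _

/-- Summing out one vertex, none of whose children matters. -/
theorem IsLocalFactor.sum_insert (hf : IsLocalFactor G f) {S : Finset (Fin n)}
    (hS : ParentClosed G S) {i : Fin n} (hi : i ∉ S) {F : (Fin n → Fin k) → ℝ}
    (hF : DependsOnlyOn F S) (g : Fin k → ℝ) :
    k * ∑ x, (∏ j ∈ insert i S, f j x) * (g (x i) * F x) =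
      ∑ x, (∏ j ∈ S, f j x) * (F x * ∑ σ, g σ * f i (Function.update x i σ)) := by
  rw [← sum_sum_update i]
  refine Finset.sum_congr rfl fun x _ => ?_
  rw [Finset.mul_sum, Finset.mul_sum]
  refine Finset.sum_congr rfl fun σ _ => ?_
  rw [Finset.prod_insert hi, hf.prod_update hS hi, hF.update hi, Function.update_self]
  ring

/-- The expectation of a function of the coordinates in a parent-closed set involves only the
factors of this set. -/
theorem IsLocalFactor.sum_eq (hG : IsDAG G) (hf : IsLocalFactor G f) {S : Finset (Fin n)}
    (hS : ParentClosed G S) {F : (Fin n → Fin k) → ℝ} (hF : DependsOnlyOn F S) :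
    ∑ x, (∏ j ∈ S, f j x) * F x = (k : ℝ) ^ Sᶜ.card * ∑ x, (∏ j, f j x) * F x := by
  induction hc : Sᶜ.card generalizing S with
  | zero =>
    have : S = Finset.univ := by simpa using hc
    simp [this]
  | succ c ih =>
    have hne : {i | i ∉ S}.Nonempty := by
      obtain ⟨i, hi⟩ := Finset.card_pos.1 (by omega : 0 < Sᶜ.card)
      exact ⟨i, by simpa using hi⟩
    -- A vertex outside S that is minimal in the ancestor order has all its parents in S, so adding
    -- it keeps S parent-closed. Sums always run over full assignments, so each coordinate without a
    -- factor contributes a factor k.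
    obtain ⟨i, hi, hmin⟩ := hG.wellFounded.has_min _ hne
    have hiS : i ∉ S := hi
    have hpa : ∀ j, G.Adj j i → j ∈ S := fun j hj => by
      by_contra h
      exact hmin j h (.single hj)
    have hT : ParentClosed G (insert i S) := by
      intro a ha b hb
      rcases Finset.mem_insert.1 ha with rfl | ha
      · exact Finset.mem_insert_of_mem (hpa b hb)
      · exact Finset.mem_insert_of_mem (hS a ha b hb)
    have hFT : DependsOnlyOn F (insert i S) := fun x y h =>
      hF x y fun j hj => h j (Finset.mem_insert_of_mem hj)
    have hcard : (insert i S)ᶜ.card = c := by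
      rw [Finset.card_compl] at hc ⊢
      rw [Finset.card_insert_of_notMem hiS]
      omega
    have h1 := ih hT hFT hcard
    have h2 := hf.sum_insert hS hiS hF (fun _ => 1)
    simp only [one_mul, hf.sum_eq_one, mul_one] at h2
    rw [← h2, h1]
    ring

theorem IsLocalFactor.sum_prod (hG : IsDAG G) (hk : 0 < k) (hf : IsLocalFactor G f) :
    ∑ x, ∏ j, f j x = 1 := by
  have h := hf.sum_eq hG (S := ∅) (fun i hi => by simp at hi) (F := fun _ => 1)
    (fun _ _ _ => rfl)
  simp only [Finset.prod_empty, mul_one, Finset.sum_const, Finset.card_univ, Fintype.card_pi,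
    Fintype.card_fin, Finset.prod_const, nsmul_eq_mul, Finset.compl_empty, Nat.cast_pow] at h
  have hk' : (k : ℝ) ^ n ≠ 0 := by positivity
  exact mul_left_cancel₀ hk' (by rw [← h, mul_one])

/-- In a factorizing distribution, the factor of `i` is the conditional probability of `X_i` given
any event that concerns non-descendants of `i`. -/
theorem IsLocalFactor.sum_indicator (hG : IsDAG G) (hk : 0 < k) (hf : IsLocalFactor G f)
    (i : Fin n) {F : (Fin n → Fin k) → ℝ} (hF : DependsOnlyOn F (nonDescendants G i))
    (σ : Fin k) :
    ∑ x, (∏ j, f j x) * ((if x i = σ then 1 else 0) * F x) =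
      ∑ x, (∏ j, f j x) * (F x * f i (Function.update x i σ)) := by
  set S := nonDescendants G i
  have hS := parentClosed_nonDescendants (G := G) i
  have hiS : i ∉ S := by simp [S, mem_nonDescendants]
  have hT : ParentClosed G (insert i S) := by
    intro a ha b hb
    rcases Finset.mem_insert.1 ha with rfl | ha
    · exact Finset.mem_insert_of_mem (hG.parents_subset _ (mem_parents.2 hb))
    · exact Finset.mem_insert_of_mem (hS a ha b hb)
  have h1 := hf.sum_eq hG hT (F := fun x => (if x i = σ then 1 else 0) * F x) fun x y h => by
    simp only [h i (Finset.mem_insert_self _ _),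
      hF x y fun j hj => h j (Finset.mem_insert_of_mem hj)]
  have h2 := hf.sum_eq hG hS (F := fun x => F x * f i (Function.update x i σ)) fun x y h => by
    simp only [hF x y h]
    congr 1
    refine hf.congr _ _ _ (by simp) fun j hj => ?_
    have hji : j ≠ i := fun e => hG.not_adj_self i (e ▸ hj)
    rw [Function.update_of_ne hji, Function.update_of_ne hji]
    exact h j (hG.parents_subset _ (mem_parents.2 hj))
  -- Summing out coordinate i against its indicator leaves the single value of `f i` at σ. The
  -- complements of S and `insert i S` differ by one vertex, which accounts for the factor k
  -- cancelled below.
  have h3 := hf.sum_insert hS hiS hF (fun τ => if τ = σ then 1 else 0)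
  simp only [ite_mul, one_mul, zero_mul, Finset.sum_ite_eq', Finset.mem_univ, if_true] at h3
  simp only [ite_mul, one_mul, zero_mul] at h1 ⊢
  rw [h1, h2] at h3
  have hc : Sᶜ.card = (insert i S)ᶜ.card + 1 := by
    have := Finset.card_le_univ (insert i S)
    rw [Finset.card_compl, Finset.card_compl]
    rw [Finset.card_insert_of_notMem hiS] at this ⊢
    omega
  rw [hc, ← mul_assoc, pow_succ'] at h3
  exact mul_left_cancel₀ (by positivity) h3

/-- The event that fixes the coordinates in S concerns only non-descendants of i, and it fixes the
parents, so the factor of i is constant on it and can be pulled out of the sum. -/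
theorem marg_insert_of_factor (hG : IsDAG G) (hk : 0 < k) (hf : IsLocalFactor G f)
    {P : PMF (Fin n → Fin k)} (hP : ∀ x, (P x).toReal = ∏ j, f j x) (i : Fin n)
    {S : Finset (Fin n)} (hS : S ⊆ nonDescendants G i) (hpa : parents G i ⊆ S)
    (x : Fin n → Fin k) : marg P ({i} ∪ S) x = f i x * marg P S x := by
  have h := hf.sum_indicator hG hk i (F := fun y => if ∀ j ∈ S, y j = x j then 1 else 0)
    (fun y z hyz => by
      have : (∀ j ∈ S, y j = x j) ↔ ∀ j ∈ S, z j = x j :=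
        forall₂_congr fun j hj => by rw [hyz j (hS hj)]
      simp only [this]) (x i)
  unfold marg
  rw [Finset.mul_sum]
  refine Eq.trans ?_ (h.trans ?_)
  · refine Finset.sum_congr rfl fun y _ => ?_
    simp only [Finset.mem_union, Finset.mem_singleton, forall_eq_or_imp, hP]
    by_cases h1 : y i = x i <;> by_cases h2 : ∀ j ∈ S, y j = x j <;> simp [h1, h2]
  · refine Finset.sum_congr rfl fun y _ => ?_
    by_cases h2 : ∀ j ∈ S, y j = x j
    · rw [if_pos h2, if_pos h2, hP, hf.congr i (Function.update y i (x i)) x (by simp)]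
      · ring
      · intro j hj
        rw [Function.update_of_ne (by rintro rfl; exact hG.not_adj_self _ hj)]
        exact h2 j (hpa (mem_parents.2 hj))
    · simp [h2]

/-- A distribution that factorizes over `G` is a Bayesian network on `G`. -/
theorem isBayesNet_of_factor (hG : IsDAG G) (hk : 0 < k) (hf : IsLocalFactor G f)
    {P : PMF (Fin n → Fin k)} (hP : ∀ x, (P x).toReal = ∏ j, f j x) : IsBayesNet G P := by
  intro i x
  rw [Finset.union_assoc, marg_insert_of_factor hG hk hf hP i
      (Finset.union_subset subset_rfl (hG.parents_subset i)) Finset.subset_union_right,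
    marg_insert_of_factor hG hk hf hP i (hG.parents_subset i) subset_rfl]
  ring

theorem exists_pmf_of_factor (hG : IsDAG G) (hk : 0 < k) (hf : IsLocalFactor G f)
    (h0 : ∀ i x, 0 ≤ f i x) :
    ∃ P : PMF (Fin n → Fin k), ∀ x, (P x).toReal = ∏ j, f j x := by
  have hnn : ∀ x, 0 ≤ ∏ j, f j x := fun x => Finset.prod_nonneg fun j _ => h0 j x
  refine ⟨PMF.ofFintype (fun x => ENNReal.ofReal (∏ j, f j x)) ?_, fun x => ?_⟩
  · rw [← ENNReal.ofReal_sum_of_nonneg fun x _ => hnn x, hf.sum_prod hG hk, ENNReal.ofReal_one]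
  · rw [PMF.ofFintype_apply, ENNReal.toReal_ofReal (hnn x)]

/-! ### The factorization of a Bayesian network -/

theorem marg_nonneg (P : PMF (Fin n → Fin k)) (S : Finset (Fin n)) (x : Fin n → Fin k) :
    0 ≤ marg P S x :=
  Finset.sum_nonneg fun y _ => by split_ifs <;> simp

theorem marg_mono (P : PMF (Fin n → Fin k)) {S T : Finset (Fin n)} (h : S ⊆ T)
    (x : Fin n → Fin k) : marg P T x ≤ marg P S x := by
  refine Finset.sum_le_sum fun y _ => ?_
  by_cases h2 : ∀ j ∈ T, y j = x j
  · rw [if_pos h2, if_pos fun j hj => h2 j (h hj)]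
  · rw [if_neg h2]
    split_ifs <;> simp

theorem marg_congr (P : PMF (Fin n → Fin k)) {S : Finset (Fin n)} {x y : Fin n → Fin k}
    (h : ∀ j ∈ S, x j = y j) : marg P S x = marg P S y := by
  refine Finset.sum_congr rfl fun z _ => ?_
  have : (∀ j ∈ S, z j = x j) ↔ ∀ j ∈ S, z j = y j := forall₂_congr fun j hj => by rw [h j hj]
  simp only [this]

theorem marg_update (P : PMF (Fin n → Fin k)) {S : Finset (Fin n)} {i : Fin n} (hi : i ∉ S)
    (x : Fin n → Fin k) (σ : Fin k) : marg P S (Function.update x i σ) = marg P S x :=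
  marg_congr P fun _ hj => Function.update_of_ne (by rintro rfl; exact hi hj) _ _

theorem sum_marg_insert (P : PMF (Fin n → Fin k)) {S : Finset (Fin n)} {j : Fin n} (hj : j ∉ S)
    (x : Fin n → Fin k) : ∑ τ, marg P (insert j S) (Function.update x j τ) = marg P S x := by
  unfold marg
  rw [Finset.sum_comm]
  refine Finset.sum_congr rfl fun y _ => ?_
  have h : ∀ τ, (∀ l ∈ insert j S, y l = Function.update x j τ l) ↔
      y j = τ ∧ ∀ l ∈ S, y l = x l := fun τ => by
    rw [Finset.forall_mem_insert, Function.update_self]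
    refine and_congr_right fun _ => forall₂_congr fun l hl => ?_
    rw [Function.update_of_ne (by rintro rfl; exact hj hl)]
  rw [Finset.sum_congr rfl fun τ _ => if_congr (h τ) rfl rfl]
  by_cases h2 : ∀ l ∈ S, y l = x l
  · simp only [ite_and, if_pos h2, Finset.sum_ite_eq, Finset.mem_univ, if_true]
  · simp only [ite_and, if_neg h2, ite_self, Finset.sum_const_zero]

/-- The definition is the case of all non-descendants. Both sides are linear in the marginals that
involve S, so a vertex outside i and its parents can be summed out of the identity, one at a time.
-/
theorem IsBayesNet.marg_mul_marg (hG : IsDAG G) {P : PMF (Fin n → Fin k)} (hP : IsBayesNet G P)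
    {i : Fin n} {S : Finset (Fin n)} (hS : S ⊆ nonDescendants G i) (hpa : parents G i ⊆ S)
    (x : Fin n → Fin k) :
    marg P (insert i S) x * marg P (parents G i) x =
      marg P (insert i (parents G i)) x * marg P S x := by
  induction hc : (nonDescendants G i \ S).card generalizing S x with
  | zero =>
    have hS' : S = nonDescendants G i :=
      hS.antisymm (Finset.sdiff_eq_empty_iff_subset.1 (Finset.card_eq_zero.1 hc))
    have h := hP i x
    rwa [Finset.union_assoc, Finset.union_eq_left.2 (hG.parents_subset i), ← hS',
      ← Finset.insert_eq, ← Finset.insert_eq] at h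
  | succ c ih =>
    obtain ⟨j, hj⟩ := Finset.card_pos.1 (by omega : 0 < (nonDescendants G i \ S).card)
    obtain ⟨hjN, hjS⟩ := Finset.mem_sdiff.1 hj
    have hji : j ≠ i := (mem_nonDescendants.1 hjN).1
    have hjp : j ∉ parents G i := fun h => hjS (hpa h)
    have hcard : (nonDescendants G i \ insert j S).card = c := by
      rw [Finset.sdiff_insert, Finset.card_erase_of_mem hj, hc]
      rfl
    have hstep := fun τ => ih (Finset.insert_subset hjN hS)
      (hpa.trans (Finset.subset_insert j S)) (Function.update x j τ) hcard
    rw [← sum_marg_insert P hjS x, ← sum_marg_insert P (S := insert i S) (j := j)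
      (by simp [hji, hjS]) x, Finset.sum_mul, Finset.mul_sum]
    refine Finset.sum_congr rfl fun τ _ => ?_
    have := hstep τ
    rwa [marg_update P hjp, marg_update P (by simp [hji, hjp] : j ∉ insert i (parents G i)),
      Finset.insert_comm] at this

/-- Chain rule: a vertex of S with no proper descendant in S is removed. The rest of S consists of
its non-descendants and contains its parents, so `IsBayesNet.marg_mul_marg` supplies the conditional
probability. -/
theorem IsBayesNet.marg_eq_prod (hG : IsDAG G) {P : PMF (Fin n → Fin k)} (hP : IsBayesNet G P)
    {S : Finset (Fin n)} (hS : ParentClosed G S) (x : Fin n → Fin k) :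
    marg P S x = ∏ i ∈ S, marg P (insert i (parents G i)) x / marg P (parents G i) x := by
  induction hc : S.card generalizing S with
  | zero =>
    rw [Finset.card_eq_zero] at hc
    subst hc
    have := P.tsum_coe
    rw [tsum_fintype] at this
    simp only [marg, Finset.notMem_empty, false_imp_iff, implies_true, if_true, Finset.prod_empty]
    rw [← ENNReal.toReal_sum fun y _ => P.apply_ne_top y, this, ENNReal.toReal_one]
  | succ c ih =>
    obtain ⟨i, hi, hmax⟩ := hG.wellFounded_swap.has_min (S : Set (Fin n))
      (Finset.card_pos.1 (by omega))
    have hiS : i ∈ S := hi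
    have hnd : S.erase i ⊆ nonDescendants G i := fun j hj => by
      rw [Finset.mem_erase] at hj
      exact mem_nonDescendants.2 ⟨hj.1, fun h => hmax j hj.2 h⟩
    have hcl : ParentClosed G (S.erase i) := fun a ha b hb => by
      rw [Finset.mem_erase] at ha ⊢
      exact ⟨fun e => hmax a ha.2 (.single (e ▸ hb)), hS a ha.2 b hb⟩
    have hpa : parents G i ⊆ S.erase i := fun j hj => by
      rw [mem_parents] at hj
      exact Finset.mem_erase.2 ⟨fun e => hG.not_adj_self i (e ▸ hj), hS i hiS j hj⟩
    have h1 := hP.marg_mul_marg hG hnd hpa x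
    rw [Finset.insert_erase hiS, ih hcl (by rw [Finset.card_erase_of_mem hiS, hc]; rfl)] at h1
    rw [← Finset.mul_prod_erase _ _ hiS]
    -- On a null parent event the ratio is 0 by the convention for division by zero. The left side
    -- is also 0, being dominated by the marginal of the parents.
    by_cases h0 : marg P (parents G i) x = 0
    · rw [h0, div_zero, zero_mul]
      exact le_antisymm ((marg_mono P (hpa.trans (Finset.erase_subset _ _)) x).trans h0.le)
        (marg_nonneg P S x)
    · rw [div_mul_eq_mul_div, eq_div_iff h0, h1]

/-- A Bayesian network is the product of its conditional probabilities. -/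
theorem IsBayesNet.eq_prod (hG : IsDAG G) {P : PMF (Fin n → Fin k)} (hP : IsBayesNet G P)
    (x : Fin n → Fin k) :
    (P x).toReal = ∏ i, marg P (insert i (parents G i)) x / marg P (parents G i) x := by
  rw [← hP.marg_eq_prod hG (S := Finset.univ) (fun _ _ _ _ => Finset.mem_univ _)]
  simp [marg, ← funext_iff]

/-! ### Codes of parent assignments -/

theorem parentList_length (i : Fin n) : (parentList G i).length = (parents G i).card := by
  classical
  rw [← List.toFinset_card_of_nodup (show (parentList G i).Nodup from
    (List.nodup_finRange n).filter _)]
  congr 1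
  ext j
  rw [List.mem_toFinset, mem_parentList, mem_parents]

theorem parentCode_lt (hk : 2 ≤ k) {d : ℕ} {i : Fin n} (hd : (parents G i).card ≤ d)
    (x : Fin n → Fin k) : parentCode G i x < k ^ d := by
  have h := Nat.ofDigits_lt_base_pow_length (b := k)
    (l := (parentList G i).map fun j : Fin n => (x j : ℕ)) hk (by simp)
  rw [List.length_map, parentList_length] at h
  exact h.trans_le (Nat.pow_le_pow_right (by omega) hd)

/-- Both digit lists have the length of the parent list, so equal numbers have equal digits even in
the presence of leading zeros. -/
theorem parentCode_eq_iff (hk : 2 ≤ k) {i : Fin n} {x y : Fin n → Fin k} :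
    parentCode G i x = parentCode G i y ↔ ∀ j ∈ parents G i, x j = y j := by
  constructor
  · intro h j hj
    have := Nat.ofDigits_inj_of_len_eq (b := k) hk
      (L1 := (parentList G i).map fun j : Fin n => (x j : ℕ))
      (L2 := (parentList G i).map fun j : Fin n => (y j : ℕ)) (by simp) (by simp) (by simp) h
    rw [List.map_inj_left] at this
    exact Fin.ext (this j (mem_parentList.2 (mem_parents.1 hj)))
  · intro h
    unfold parentCode
    congr 1
    refine List.map_congr_left fun j hj => ?_
    rw [h j (mem_parents.2 (mem_parentList.1 hj))]

end

/-! ### Total variation distance and relative entropy -/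

section

variable {α : Type*} [Fintype α]

/-- A weak form of Pinsker's inequality. -/
theorem sq_half_sum_abs_sub_le {p q : α → ℝ} (hp : ∀ x, 0 ≤ p x) (hq : ∀ x, 0 < q x)
    (hp1 : ∑ x, p x = 1) (hq1 : ∑ x, q x = 1) :
    ((1 / 2) * ∑ x, |p x - q x|) ^ 2 ≤ ∑ x, p x * Real.log (p x / q x) := by
  -- Comparison through the Hellinger affinity b: Cauchy–Schwarz for |p - q| = |√p - √q| (√p + √q)
  -- gives (1 - b)(1 + b) ≤ 2(1 - b), and the last quantity is at most the relative entropy by log t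
  -- ≤ t - 1 at t = √(q/p).
  set b := ∑ x, √(p x) * √(q x) with hb
  have hb0 : 0 ≤ b := Finset.sum_nonneg fun x _ => by positivity
  have hsq : ∀ x, √(p x) ^ 2 = p x ∧ √(q x) ^ 2 = q x := fun x =>
    ⟨Real.sq_sqrt (hp x), Real.sq_sqrt (hq x).le⟩
  have hminus : ∑ x, |√(p x) - √(q x)| ^ 2 = 2 * (1 - b) := by
    have : ∀ x, |√(p x) - √(q x)| ^ 2 = p x + q x - 2 * (√(p x) * √(q x)) := fun x => by
      rw [sq_abs, sub_sq, (hsq x).1, (hsq x).2]; ring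
    simp only [this, Finset.sum_sub_distrib, Finset.sum_add_distrib, ← Finset.mul_sum, hp1, hq1]
    ring
  have hplus : ∑ x, (√(p x) + √(q x)) ^ 2 = 2 * (1 + b) := by
    have : ∀ x, (√(p x) + √(q x)) ^ 2 = p x + q x + 2 * (√(p x) * √(q x)) := fun x => by
      rw [add_sq, (hsq x).1, (hsq x).2]; ring
    simp only [this, Finset.sum_add_distrib, ← Finset.mul_sum, hp1, hq1]
    ring
  have hcs := Finset.sum_mul_sq_le_sq_mul_sq Finset.univ (fun x => |√(p x) - √(q x)|)
    (fun x => √(p x) + √(q x))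
  have habs : ∀ x, |√(p x) - √(q x)| * (√(p x) + √(q x)) = |p x - q x| := fun x => by
    have := hsq x
    have h := abs_mul (√(p x) - √(q x)) (√(p x) + √(q x))
    rw [abs_of_nonneg (by positivity : 0 ≤ √(p x) + √(q x))] at h
    rw [← h]
    congr 1
    linear_combination this.1 - this.2
  simp only [habs, hminus, hplus] at hcs
  have hkl : 2 * (1 - b) ≤ ∑ x, p x * Real.log (p x / q x) := by
    rw [hb, ← hp1, ← Finset.sum_sub_distrib, Finset.mul_sum]
    refine Finset.sum_le_sum fun x _ => ?_
    rcases (hp x).eq_or_lt with h0 | h0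
    · simp [← h0]
    · have h1 := Real.log_le_sub_one_of_pos (x := √(q x) / √(p x))
        (div_pos (Real.sqrt_pos.2 (hq x)) (Real.sqrt_pos.2 h0))
      have h3 : Real.log (√(q x) / √(p x)) = -(Real.log (p x / q x) / 2) := by
        rw [← Real.sqrt_div (hq x).le, Real.log_sqrt (div_pos (hq x) h0).le,
          Real.log_div (hq x).ne' h0.ne', Real.log_div h0.ne' (hq x).ne']
        ring
      rw [h3] at h1
      have h2 : √(p x) * √(q x) = p x * (√(q x) / √(p x)) := by
        have := Real.sqrt_pos.2 h0
        field_simp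
        rw [(hsq x).1, mul_comm]
      rw [h2]
      nlinarith [hp x]
  have hb1 : b ≤ 1 := by
    have : 0 ≤ 2 * (1 - b) := hminus ▸ Finset.sum_nonneg fun x _ => by positivity
    linarith
  nlinarith

/-- Where P is positive all its factors are positive, so the logarithm of the ratio splits into a
sum, and log t ≤ t - 1 applies to each term. Points with P = 0 contribute nothing. -/
theorem sum_mul_log_prod_le {ι : Type*} [Fintype ι] {P Q : α → ℝ} {p q : ι → α → ℝ}
    (hP : ∀ x, P x = ∏ i, p i x) (hQ : ∀ x, Q x = ∏ i, q i x) (hp : ∀ i x, 0 ≤ p i x)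
    (hq : ∀ i x, 0 < q i x) :
    ∑ x, P x * Real.log (P x / Q x) ≤ ∑ i, ∑ x, P x * (p i x / q i x - 1) := by
  rw [Finset.sum_comm]
  refine Finset.sum_le_sum fun x _ => ?_
  rw [← Finset.mul_sum]
  have hP0 : 0 ≤ P x := hP x ▸ Finset.prod_nonneg fun i _ => hp i x
  rcases hP0.eq_or_lt with h0 | h0
  · simp [← h0]
  · have hpos : ∀ i, 0 < p i x := fun i => (hp i x).lt_of_ne' fun h => h0.ne' <| by
      rw [hP]; exact Finset.prod_eq_zero (Finset.mem_univ i) h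
    refine mul_le_mul_of_nonneg_left ?_ h0.le
    rw [hP, hQ, ← Finset.prod_div_distrib,
      Real.log_prod fun i _ => (div_pos (hpos i) (hq i x)).ne']
    exact Finset.sum_le_sum fun i _ => Real.log_le_sub_one_of_pos (div_pos (hpos i) (hq i x))

end

/-! ### Smoothed empirical conditional distributions -/

/-- The count `c` is within the Bernstein deviation (with parameter `L`) of its mean `a`. -/
def CountClose (L a c : ℝ) : Prop := (c - a) ^ 2 ≤ 4 * L * (a + L)

/-- If the inequality failed, the deviation would exceed (a + 5L)/2, whose square minus 4L(a + L) is
(a - 3L)²/4 ≥ 0. Equality is possible at a = 3L, which explains the pseudo-count 3L. -/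
theorem CountClose.half_le {L a c : ℝ} (hL : 0 < L) (ha : 0 ≤ a) (h : CountClose L a c) :
    (a + L) / 2 ≤ c + 3 * L := by
  unfold CountClose at h
  by_contra! hlt
  have h2 : ((a + 5 * L) / 2) ^ 2 < (a - c) ^ 2 :=
    pow_lt_pow_left₀ (by linarith) (by positivity) two_ne_zero
  nlinarith [sq_nonneg (a - 3 * L)]

/-- One term of the χ²-divergence. Over a common denominator it is (pB - A)²/(AB), where A and B are
at least half of Mp + L and M + kL. The constant 12 is 3, from squaring a sum of three errors, times
4, from the two halves. -/
theorem sq_div_term_le {k L M N p c : ℝ} (hk : 1 ≤ k) (hL : 0 < L) (hM : 0 < M) (hp : 0 ≤ p)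
    (hp1 : p ≤ 1) (hc : CountClose L (M * p) c) (hN : CountClose L M N) :
    M * ((p - (c + 3 * L) / (N + 3 * k * L)) ^ 2 / ((c + 3 * L) / (N + 3 * k * L))) ≤
      12 * (17 * L + 9 * k * L * p) := by
  have hA := hc.half_le hL (by positivity)
  have hB : (M + k * L) / 2 ≤ N + 3 * k * L := by
    have := hN.half_le hL hM.le
    nlinarith
  set A := c + 3 * L with hAdef
  set B := N + 3 * k * L with hBdef
  have hA0 : 0 < A := lt_of_lt_of_le (by positivity) hA
  have hB0 : 0 < B := lt_of_lt_of_le (by positivity) hB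
  have hU : 0 < M * p + L := by positivity
  have hV : 0 < M + k * L := by positivity
  have e1 : (p - A / B) ^ 2 / (A / B) = (p * B - A) ^ 2 / (A * B) := by
    field_simp
  -- The three errors: fluctuation of the parent count, fluctuation of the family count, and
  -- smoothing bias.
  have e2 : p * B - A = p * (N - M) - (c - M * p) + 3 * L * (p * k - 1) := by
    rw [hAdef, hBdef]; ring
  have e3 : (p * B - A) ^ 2 ≤
      3 * (p ^ 2 * (4 * L * (M + L)) + 4 * L * (M * p + L) + (3 * L * (p * k - 1)) ^ 2) := by
    unfold CountClose at hc hN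
    rw [e2]
    have h1 := mul_le_mul_of_nonneg_left hN (sq_nonneg p)
    set u := p * (N - M) with hu
    set v := c - M * p
    set w := 3 * L * (p * k - 1)
    have h2 : p ^ 2 * (N - M) ^ 2 = u ^ 2 := by rw [hu]; ring
    nlinarith [sq_nonneg (u + v), sq_nonneg (u - w), sq_nonneg (v + w)]
  have hpk : (p * k - 1) ^ 2 ≤ p ^ 2 * k ^ 2 + 1 := by
    have : 0 ≤ p * k := by positivity
    nlinarith
  have hpp : p ^ 2 * (M + L) ≤ M * p + L := by
    have h1 : p ^ 2 ≤ p := by nlinarith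
    have h2 : p ^ 2 ≤ 1 := by nlinarith
    nlinarith
  have e4 : (p * B - A) ^ 2 ≤ 3 * (8 * L * (M * p + L) + 9 * L ^ 2 * (p ^ 2 * k ^ 2 + 1)) := by
    linarith [mul_le_mul_of_nonneg_left hpp hL.le,
      mul_le_mul_of_nonneg_left hpk (by positivity : 0 ≤ 9 * L ^ 2)]
  have e5 : (M * p + L) * (M + k * L) ≤ 4 * (A * B) := by
    linarith [mul_le_mul hA hB (by positivity) hA0.le]
  have e6 : M * (8 * L * (M * p + L) + 9 * L ^ 2 * (p ^ 2 * k ^ 2 + 1)) ≤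
      (17 * L + 9 * k * L * p) * ((M * p + L) * (M + k * L)) := by
    have h1 : M * (M * p + L) ≤ (M * p + L) * (M + k * L) := by
      linarith [mul_pos hU (by positivity : 0 < k * L)]
    have h2 : M * L ^ 2 ≤ L * ((M * p + L) * (M + k * L)) := by
      have : 0 ≤ L * (M * p * (M + k * L) + L * (k * L)) := by positivity
      linarith
    have h3 : M * (L ^ 2 * (p ^ 2 * k ^ 2)) ≤ k * L * p * ((M * p + L) * (M + k * L)) := by
      have : 0 ≤ k * L * p * (M * p * M + L * M + L * (k * L)) := by positivity
      linarith
    linarith [mul_le_mul_of_nonneg_left h1 (by positivity : 0 ≤ 8 * L)]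
  rw [e1, ← mul_div_assoc, div_le_iff₀ (by positivity)]
  have h0 : 0 ≤ 17 * L + 9 * k * L * p := by positivity
  linarith [mul_le_mul_of_nonneg_left e4 hM.le, mul_le_mul_of_nonneg_left e5 h0]

/-- The `χ²`-divergence of a distribution on `k` points from its smoothed empirical version. -/
theorem smoothed_chiSq_le {k : ℕ} (hk : 1 ≤ k) {L M : ℝ} (hL : 0 < L) (hM : 0 < M)
    {p c : Fin k → ℝ} (hp : ∀ σ, 0 ≤ p σ) (hp1 : ∑ σ, p σ = 1)
    (hc : ∀ σ, CountClose L (M * p σ) (c σ)) (hN : CountClose L M (∑ σ, c σ)) :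
    M * ∑ σ, p σ * (p σ / ((c σ + 3 * L) / (∑ τ, c τ + 3 * k * L)) - 1) ≤ 312 * (k * L) := by
  have hk' : (1 : ℝ) ≤ k := by exact_mod_cast hk
  set B := ∑ τ, c τ + 3 * k * L with hBdef
  have hB0 : 0 < B := by
    have := hN.half_le hL hM.le
    nlinarith
  set q : Fin k → ℝ := fun σ => (c σ + 3 * L) / B with hq
  have hq0 : ∀ σ, 0 < q σ := fun σ => by
    have h1 := (hc σ).half_le hL (mul_nonneg hM.le (hp σ))
    have h2 := mul_nonneg hM.le (hp σ)
    exact div_pos (by linarith) hB0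
  have hq1 : ∑ σ, q σ = 1 := by
    simp only [hq]
    rw [← Finset.sum_div, div_eq_one_iff_eq hB0.ne', Finset.sum_add_distrib]
    simp [hBdef]
    ring
  -- The two forms of the χ²-divergence agree because p and q both have total mass 1.
  have e1 : ∑ σ, p σ * (p σ / q σ - 1) = ∑ σ, (p σ - q σ) ^ 2 / q σ := by
    have : ∀ σ, (p σ - q σ) ^ 2 / q σ = p σ * (p σ / q σ - 1) + (q σ - p σ) := fun σ => by
      have := (hq0 σ).ne'
      field_simp
      ring
    simp only [this, Finset.sum_add_distrib, Finset.sum_sub_distrib, hp1, hq1]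
    ring
  rw [e1, Finset.mul_sum]
  have hp_le : ∀ σ, p σ ≤ 1 := fun σ =>
    hp1 ▸ Finset.single_le_sum (fun τ _ => hp τ) (Finset.mem_univ σ)
  -- Summed over the k symbols, 12(17L + 9kLp) becomes 12(17 + 9)kL = 312kL.
  refine (Finset.sum_le_sum fun σ _ =>
    sq_div_term_le hk' hL hM (hp σ) (hp_le σ) (hc σ) hN).trans (le_of_eq ?_)
  rw [← Finset.mul_sum, Finset.sum_add_distrib, ← Finset.mul_sum (f := p), hp1]
  simp
  ring

/-! ### Concentration of counts -/

section

open ProbabilityTheory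

variable {α : Type*}

open Classical in
/-- The number of the first `m` samples that satisfy `E`. -/
noncomputable def count (E : α → Prop) (m : ℕ) (ω : ℕ → α) : ℕ :=
  ∑ t ∈ Finset.range m, if E (ω t) then 1 else 0

open Classical in
/-- The probability of `E`. -/
noncomputable def prob [Fintype α] (P : PMF α) (E : α → Prop) : ℝ :=
  ∑ x, if E x then (P x).toReal else 0

theorem prob_nonneg [Fintype α] (P : PMF α) (E : α → Prop) : 0 ≤ prob P E :=
  Finset.sum_nonneg fun x _ => by split_ifs <;> simp

theorem sum_toReal [Fintype α] (P : PMF α) : ∑ x, (P x).toReal = 1 := by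
  have := P.tsum_coe
  rw [tsum_fintype] at this
  rw [← ENNReal.toReal_sum fun y _ => P.apply_ne_top y, this, ENNReal.toReal_one]

open Classical in
/-- The indicator of `E` for sample number `t`. -/
noncomputable def hit (E : α → Prop) (t : ℕ) (ω : ℕ → α) : ℝ := if E (ω t) then 1 else 0

variable [MeasurableSpace α] [DiscreteMeasurableSpace α]

theorem measurable_hit (E : α → Prop) (t : ℕ) : Measurable (hit E t) :=
  (Measurable.of_discrete (f := fun x => open Classical in if E x then (1 : ℝ) else 0)).comp
    (measurable_pi_apply t)

variable [Fintype α]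

/-- The moment generating function of an indicator is 1 + π(exp l - 1), which 1 + t ≤ exp t bounds
by that of a Poisson variable with the same mean. -/
theorem mgf_hit_le (P : PMF α) (E : α → Prop) (t : ℕ) (l : ℝ) :
    mgf (hit E t) (Measure.infinitePi fun _ : ℕ => P.toMeasure) l ≤
      Real.exp (prob P E * (Real.exp l - 1)) := by
  classical
  have hmp := measurePreserving_eval_infinitePi (fun _ : ℕ => P.toMeasure) t
  have h1 : mgf (hit E t) (Measure.infinitePi fun _ : ℕ => P.toMeasure) l =
      ∫ x, Real.exp (l * if E x then 1 else 0) ∂P.toMeasure := by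
    have h := integral_map (μ := Measure.infinitePi fun _ : ℕ => P.toMeasure)
      (f := fun x => Real.exp (l * if E x then 1 else 0)) hmp.measurable.aemeasurable (Measurable.of_discrete).aestronglyMeasurable
    rw [hmp.map_eq] at h
    exact h.symm
  have h2 : ∀ x, (P x).toReal * Real.exp (l * if E x then 1 else 0) =
      (P x).toReal + (if E x then (P x).toReal else 0) * (Real.exp l - 1) := fun x => by
    by_cases h : E x
    · simp only [h, if_true, mul_one]; ring
    · simp [h]
  rw [h1, PMF.integral_eq_sum]
  simp only [smul_eq_mul, h2, Finset.sum_add_distrib, ← Finset.sum_mul, sum_toReal]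
  have := Real.add_one_le_exp (prob P E * (Real.exp l - 1))
  rw [prob] at this ⊢
  linarith

theorem exp_sub_one_le {l : ℝ} (h : |l| ≤ 1) : Real.exp l - 1 ≤ l + l ^ 2 := by
  have := Real.abs_exp_sub_one_sub_id_le h
  have := le_abs_self (Real.exp l - 1 - l)
  linarith

theorem mgf_sum_hit_le (P : PMF α) (E : α → Prop) (m : ℕ) {l : ℝ} (hl : |l| ≤ 1) :
    mgf (fun ω => ∑ t ∈ Finset.range m, hit E t ω)
      (Measure.infinitePi fun _ : ℕ => P.toMeasure) l ≤
      Real.exp (m * prob P E * (l + l ^ 2)) := by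
  classical
  have hind : iIndepFun (fun t ω => hit E t ω) (Measure.infinitePi fun _ : ℕ => P.toMeasure) :=
    iIndepFun_infinitePi (P := fun _ : ℕ => P.toMeasure)
      (X := fun _ x => if E x then (1 : ℝ) else 0) fun _ => Measurable.of_discrete
  have := hind.mgf_sum (measurable_hit E) (Finset.range m) (t := l)
  have e : (fun ω => ∑ t ∈ Finset.range m, hit E t ω) = ∑ t ∈ Finset.range m, hit E t := by
    ext ω; simp
  rw [e, this]
  refine (Finset.prod_le_prod (fun _ _ => mgf_nonneg) fun t _ => mgf_hit_le P E t l).trans ?_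
  rw [Finset.prod_const, Finset.card_range, ← Real.exp_nat_mul, mul_assoc]
  gcongr
  · exact prob_nonneg P E
  · exact exp_sub_one_le hl

/-- Chernoff's method with parameters l and -l. The threshold is chosen so that the exponent
collapses to -L; optimizing l is left to the user of the bound. -/
theorem measureReal_lt_sub_le (P : PMF α) (E : α → Prop) (m : ℕ) {L l : ℝ} (hl : 0 < l)
    (hl1 : l ≤ 1) :
    (Measure.infinitePi fun _ : ℕ => P.toMeasure).real
        {ω | m * prob P E * l + L / l ≤ count E m ω - m * prob P E} ≤ Real.exp (-L) ∧
      (Measure.infinitePi fun _ : ℕ => P.toMeasure).real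
        {ω | m * prob P E * l + L / l ≤ m * prob P E - count E m ω} ≤ Real.exp (-L) := by
  classical
  set μ := Measure.infinitePi fun _ : ℕ => P.toMeasure
  set X : (ℕ → α) → ℝ := fun ω => ∑ t ∈ Finset.range m, hit E t ω with hX
  have hXc : ∀ ω, X ω = count E m ω := fun ω => by simp [hX, hit, count]
  have hXm : Measurable X := Finset.measurable_sum _ fun t _ => measurable_hit E t
  have hint : ∀ s : ℝ, Integrable (fun ω => Real.exp (s * X ω)) μ := fun s => by
    refine Integrable.of_bound (by fun_prop) (Real.exp (|s| * m)) (.of_forall fun ω => ?_)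
    rw [Real.norm_eq_abs, Real.abs_exp, hXc]
    have h1 : count E m ω ≤ m := by
      refine (Finset.sum_le_card_nsmul _ _ 1 fun t _ => ?_).trans (by simp)
      split_ifs <;> simp
    have h2 : (count E m ω : ℝ) ≤ m := by exact_mod_cast h1
    gcongr
    exact le_abs_self s
  have hab : |l| ≤ 1 := by rwa [abs_of_pos hl]
  set a := m * prob P E
  constructor
  · have h := measure_ge_le_exp_mul_mgf (μ := μ) (X := X) (a * l + L / l + a) hl.le (hint l)
    have e : {ω | a * l + L / l ≤ count E m ω - a} = {ω | a * l + L / l + a ≤ X ω} := by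
      ext ω
      simp only [Set.mem_ofPred_eq, hXc]
      constructor <;> intro h <;> linarith
    rw [e]
    refine h.trans ((mul_le_mul_of_nonneg_left (mgf_sum_hit_le P E m hab)
      (Real.exp_pos _).le).trans (le_of_eq ?_))
    rw [← Real.exp_add]
    congr 1
    field_simp
    ring
  · have h := measure_le_le_exp_mul_mgf (μ := μ) (X := X) (a - (a * l + L / l))
      (neg_nonpos.2 hl.le) (hint (-l))
    have e : {ω | a * l + L / l ≤ a - count E m ω} = {ω | X ω ≤ a - (a * l + L / l)} := by
      ext ω
      simp only [Set.mem_ofPred_eq, hXc]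
      constructor <;> intro h <;> linarith
    rw [e]
    refine h.trans ((mul_le_mul_of_nonneg_left (mgf_sum_hit_le P E m (by rwa [abs_neg]))
      (Real.exp_pos _).le).trans (le_of_eq ?_))
    rw [← Real.exp_add]
    congr 1
    field_simp
    ring

/-- A two-sided Bernstein inequality for the number of samples that satisfy `E`. -/
theorem measureReal_not_countClose_le (P : PMF α) (E : α → Prop) (m : ℕ) {L : ℝ} (hL : 0 < L) :
    (Measure.infinitePi fun _ : ℕ => P.toMeasure).real
      {ω | ¬ CountClose L (m * prob P E) (count E m ω)} ≤ 2 * Real.exp (-L) := by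
  set a := m * prob P E with ha
  have ha0 : 0 ≤ a := mul_nonneg (Nat.cast_nonneg m) (prob_nonneg P E)
  -- The unconstrained optimum is l = √(L/a), with deviation 2√(aL). When a ≤ L it may exceed the
  -- allowed range, and l = 1 is good enough.
  obtain ⟨l, hl, hl1, hal⟩ : ∃ l : ℝ, 0 < l ∧ l ≤ 1 ∧ (a * l + L / l) ^ 2 ≤ 4 * L * (a + L) := by
    rcases le_total a L with h | h
    · refine ⟨1, one_pos, le_rfl, ?_⟩
      nlinarith
    · have ha1 : 0 < a := hL.trans_le h
      have hs : √(L / a) ^ 2 = L / a := Real.sq_sqrt (by positivity)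
      have hs0 : 0 < √(L / a) := Real.sqrt_pos.2 (by positivity)
      refine ⟨√(L / a), hs0, Real.sqrt_le_one.2 (by rwa [div_le_one ha1]), ?_⟩
      have e : L / √(L / a) = a * √(L / a) := by
        rw [div_eq_iff hs0.ne', mul_assoc, ← sq, hs]
        field_simp
      have e2 : (a * √(L / a) + a * √(L / a)) ^ 2 = 4 * L * a := by
        have : (a * √(L / a) + a * √(L / a)) ^ 2 = 4 * a ^ 2 * √(L / a) ^ 2 := by ring
        rw [this, hs]
        field_simp
      rw [e, e2]
      nlinarith
  obtain ⟨h1, h2⟩ := measureReal_lt_sub_le P E m (L := L) hl hl1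
  refine (measureReal_mono (fun ω hω => ?_)).trans
    ((measureReal_union_le _ _).trans ((add_le_add h1 h2).trans (by rw [two_mul])))
  simp only [Set.mem_union, Set.mem_ofPred_eq] at hω ⊢
  by_contra! h
  refine hω ((sq_le_sq' ?_ h.1.le).trans hal)
  linarith [h.2]

end

/-! ### Add-constant estimators of conditional probabilities -/

section

variable {n k : ℕ} (G : Digraph (Fin n))

/-- The parents of `i` have the values with code `a`. -/
def ParentEvent (i : Fin n) (a : ℕ) (x : Fin n → Fin k) : Prop := parentCode G i x = a

/-- The parents of `i` have the values with code `a`, and `i` has value `σ`. -/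
def FamilyEvent (i : Fin n) (a : ℕ) (σ : Fin k) (x : Fin n → Fin k) : Prop :=
  parentCode G i x = a ∧ x i = σ

/-- Numerator of the smoothed empirical conditional probability. -/
noncomputable def estNum (L m : ℕ) (ω : ℕ → Fin n → Fin k) (i : Fin n) (a : ℕ) (σ : Fin k) : ℕ :=
  3 * L + count (FamilyEvent G i a σ) m ω

/-- Denominator of the smoothed empirical conditional probability. -/
noncomputable def estDen (L m : ℕ) (ω : ℕ → Fin n → Fin k) (i : Fin n) (a : ℕ) : ℕ :=
  3 * k * L + count (ParentEvent G i a) m ω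

/-- The smoothed empirical conditional probability of `X_i = x_i` given the parents. -/
noncomputable def estFactor (L m : ℕ) (ω : ℕ → Fin n → Fin k) (i : Fin n) (x : Fin n → Fin k) : ℝ :=
  estNum G L m ω i (parentCode G i x) (x i) / estDen G L m ω i (parentCode G i x)

theorem sum_count_familyEvent (m : ℕ) (ω : ℕ → Fin n → Fin k) (i : Fin n) (a : ℕ) :
    ∑ σ, count (FamilyEvent G i a σ) m ω = count (ParentEvent G i a) m ω := by
  classical
  unfold count
  rw [Finset.sum_comm]
  refine Finset.sum_congr rfl fun t _ => ?_
  by_cases h : ParentEvent G i a (ω t)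
  · rw [if_pos h, Finset.sum_eq_single_of_mem ((ω t) i) (Finset.mem_univ _), if_pos ⟨h, rfl⟩]
    exact fun σ _ hσ => if_neg fun h => hσ h.2.symm
  · rw [if_neg h]
    exact Finset.sum_eq_zero fun σ _ => if_neg fun h' => h h'.1

theorem sum_estNum (L m : ℕ) (ω : ℕ → Fin n → Fin k) (i : Fin n) (a : ℕ) :
    ∑ σ, estNum G L m ω i a σ = estDen G L m ω i a := by
  simp only [estNum, estDen, Finset.sum_add_distrib, sum_count_familyEvent]
  simp
  ring

variable {G}

theorem estDen_pos {L : ℕ} (hk : 0 < k) (hL : 0 < L) (m : ℕ) (ω : ℕ → Fin n → Fin k) (i : Fin n)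
    (a : ℕ) : 0 < estDen G L m ω i a :=
  Nat.add_pos_left (by positivity) _

theorem estFactor_pos {L : ℕ} (hk : 0 < k) (hL : 0 < L) (m : ℕ) (ω : ℕ → Fin n → Fin k)
    (i : Fin n) (x : Fin n → Fin k) : 0 < estFactor G L m ω i x := by
  refine div_pos ?_ (Nat.cast_pos.2 (estDen_pos hk hL m ω i _))
  exact Nat.cast_pos.2 (Nat.add_pos_left (by positivity) _)

theorem parentCode_congr {i : Fin n} {x y : Fin n → Fin k} (h : ∀ j, G.Adj j i → x j = y j) :
    parentCode G i x = parentCode G i y := by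
  unfold parentCode
  congr 1
  refine List.map_congr_left fun j hj => ?_
  rw [h j (mem_parentList.1 hj)]

theorem isLocalFactor_estFactor (hG : IsDAG G) {L : ℕ} (hk : 0 < k) (hL : 0 < L) (m : ℕ)
    (ω : ℕ → Fin n → Fin k) : IsLocalFactor G (estFactor G L m ω) where
  congr i x y hi h := by rw [estFactor, estFactor, parentCode_congr h, hi]
  sum_eq_one i x := by
    have h : ∀ σ, parentCode G i (Function.update x i σ) = parentCode G i x := fun σ =>
      parentCode_congr fun j hj =>
        Function.update_of_ne (by rintro rfl; exact hG.not_adj_self _ hj) _ _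
    simp only [estFactor, h, Function.update_self]
    rw [← Finset.sum_div, ← Nat.cast_sum, sum_estNum, div_self]
    exact Nat.cast_ne_zero.2 (estDen_pos hk hL m ω i _).ne'

theorem marg_parents (hk : 2 ≤ k) (P : PMF (Fin n → Fin k)) (i : Fin n) (x : Fin n → Fin k) :
    marg P (parents G i) x = prob P (ParentEvent G i (parentCode G i x)) := by
  classical
  unfold marg prob
  exact Finset.sum_congr rfl fun y _ => if_congr (parentCode_eq_iff hk).symm rfl rfl

theorem marg_family (hk : 2 ≤ k) (P : PMF (Fin n → Fin k)) (i : Fin n) (x : Fin n → Fin k) :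
    marg P (insert i (parents G i)) x =
      prob P (FamilyEvent G i (parentCode G i x) (x i)) := by
  classical
  unfold marg prob
  refine Finset.sum_congr rfl fun y _ => if_congr ?_ rfl rfl
  rw [Finset.forall_mem_insert, FamilyEvent, parentCode_eq_iff hk, and_comm]

theorem sum_prob_familyEvent (P : PMF (Fin n → Fin k)) (i : Fin n) (a : ℕ) :
    ∑ σ, prob P (FamilyEvent G i a σ) = prob P (ParentEvent G i a) := by
  classical
  unfold prob
  rw [Finset.sum_comm]
  refine Finset.sum_congr rfl fun t _ => ?_
  by_cases h : ParentEvent G i a t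
  · rw [if_pos h, Finset.sum_eq_single_of_mem (t i) (Finset.mem_univ _), if_pos ⟨h, rfl⟩]
    exact fun σ _ hσ => if_neg fun h => hσ h.2.symm
  · rw [if_neg h]
    exact Finset.sum_eq_zero fun σ _ => if_neg fun h' => h h'.1

/-- Assignments are grouped by parent code and own symbol. The range k ^ d serves all vertices at
once; codes that no assignment attains contribute probability 0. -/
theorem sum_eq_sum_familyEvent (hk : 2 ≤ k) {d : ℕ} (P : PMF (Fin n → Fin k)) {i : Fin n}
    (hd : (parents G i).card ≤ d) (h : ℕ → Fin k → ℝ) :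
    ∑ x, (P x).toReal * h (parentCode G i x) (x i) =
      ∑ a ∈ Finset.range (k ^ d), ∑ σ, prob P (FamilyEvent G i a σ) * h a σ := by
  classical
  have e : ∀ x, (P x).toReal * h (parentCode G i x) (x i) =
      ∑ a ∈ Finset.range (k ^ d), ∑ σ,
        (if FamilyEvent G i a σ x then (P x).toReal else 0) * h a σ := fun x => by
    rw [Finset.sum_eq_single_of_mem (parentCode G i x)
        (Finset.mem_range.2 (parentCode_lt hk hd x)),
      Finset.sum_eq_single_of_mem (x i) (Finset.mem_univ _), if_pos ⟨rfl, rfl⟩]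
    · intro σ _ hσ
      rw [if_neg fun h => hσ h.2.symm, zero_mul]
    · intro a _ ha
      refine Finset.sum_eq_zero fun σ _ => ?_
      rw [if_neg fun h => ha h.1.symm, zero_mul]
  simp only [e, prob, Finset.sum_mul]
  rw [Finset.sum_comm]
  refine Finset.sum_congr rfl fun a _ => ?_
  rw [Finset.sum_comm]

/-- All counts are close to their means. -/
def AllClose (G : Digraph (Fin n)) (d L m : ℕ) (P : PMF (Fin n → Fin k))
    (ω : ℕ → Fin n → Fin k) : Prop :=
  ∀ (i : Fin n), ∀ a ∈ Finset.range (k ^ d),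
    CountClose L (m * prob P (ParentEvent G i a)) (count (ParentEvent G i a) m ω) ∧
      ∀ σ, CountClose L (m * prob P (FamilyEvent G i a σ)) (count (FamilyEvent G i a σ) m ω)

/-- `smoothed_chiSq_le` is applied with M = mπ, π being the probability of the parent event.
Weighting by π absorbs this factor, so the bound does not depend on π. If π = 0, all weights vanish.
-/
theorem AllClose.chiSq_le (hk : 2 ≤ k) {d L m : ℕ} (hL : 0 < L) (hm : 0 < m)
    {P : PMF (Fin n → Fin k)} {ω : ℕ → Fin n → Fin k} (h : AllClose G d L m P ω) (i : Fin n)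
    {a : ℕ} (ha : a ∈ Finset.range (k ^ d)) :
    ∑ σ, prob P (FamilyEvent G i a σ) *
      (prob P (FamilyEvent G i a σ) / prob P (ParentEvent G i a) /
        ((estNum G L m ω i a σ : ℝ) / estDen G L m ω i a) - 1) ≤ 312 * (k * L) / m := by
  obtain ⟨hN, hc⟩ := h i a ha
  have hm' : (0 : ℝ) < m := Nat.cast_pos.2 hm
  have hL' : (0 : ℝ) < L := Nat.cast_pos.2 hL
  set π := prob P (ParentEvent G i a) with hπ
  have hsum := sum_prob_familyEvent (G := G) P i a
  have hr : ∀ σ, 0 ≤ prob P (FamilyEvent G i a σ) := fun σ => prob_nonneg P _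
  rcases (prob_nonneg P (ParentEvent G i a)).eq_or_lt with h0 | h0
  · rw [← h0] at hsum
    have hz := (Finset.sum_eq_zero_iff_of_nonneg fun σ _ => hr σ).1 hsum
    rw [Finset.sum_eq_zero fun σ hσ => by rw [hz σ hσ, zero_mul]]
    positivity
  · rw [← hπ] at h0 hsum
    have e : ∀ σ, (m : ℝ) * π * (prob P (FamilyEvent G i a σ) / π) =
        m * prob P (FamilyEvent G i a σ) := fun σ => by field_simp
    have hcount : ((count (ParentEvent G i a) m ω : ℕ) : ℝ) =
        ∑ σ, (count (FamilyEvent G i a σ) m ω : ℝ) := by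
      rw [← sum_count_familyEvent, Nat.cast_sum]
    have := smoothed_chiSq_le (k := k) (by omega) hL' (M := m * π) (by positivity)
      (p := fun σ => prob P (FamilyEvent G i a σ) / π)
      (c := fun σ => count (FamilyEvent G i a σ) m ω) (fun σ => div_nonneg (hr σ) h0.le)
      (by rw [← Finset.sum_div, hsum, div_self h0.ne']) (fun σ => by rw [e]; exact hc σ)
      (by rw [← hcount]; exact hN)
    rw [le_div_iff₀ hm', Finset.sum_mul]
    rw [Finset.mul_sum] at this
    refine (le_of_eq (Finset.sum_congr rfl fun σ _ => ?_)).trans this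
    rw [← mul_assoc, e, ← hcount]
    simp only [estNum, estDen, Nat.cast_add, Nat.cast_mul, Nat.cast_ofNat]
    rw [add_comm (3 * (L : ℝ)), add_comm (3 * (k : ℝ) * L)]
    ring

theorem AllClose.tvDist_sq_le (hG : IsDAG G) (hk : 2 ≤ k) {d L m : ℕ} (hL : 0 < L) (hm : 0 < m)
    (hd : ∀ i, (parents G i).card ≤ d) {P Q : PMF (Fin n → Fin k)} (hP : IsBayesNet G P)
    {ω : ℕ → Fin n → Fin k} (hQ : ∀ x, (Q x).toReal = ∏ i, estFactor G L m ω i x)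
    (h : AllClose G d L m P ω) :
    tvDist P Q ^ 2 ≤ 312 * ((k : ℝ) ^ (d + 1) * n * L) / m := by
  have hk0 : 0 < k := by omega
  refine (sq_half_sum_abs_sub_le (fun x => ENNReal.toReal_nonneg)
    (fun x => hQ x ▸ Finset.prod_pos fun i _ => estFactor_pos hk0 hL m ω i x)
    (sum_toReal P) (sum_toReal Q)).trans ?_
  refine (sum_mul_log_prod_le (hP.eq_prod hG) hQ
    (fun i x => div_nonneg (marg_nonneg P _ x) (marg_nonneg P _ x))
    fun i x => estFactor_pos hk0 hL m ω i x).trans ?_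
  have key : ∀ i, ∑ x, (P x).toReal *
      (marg P (insert i (parents G i)) x / marg P (parents G i) x / estFactor G L m ω i x - 1) ≤
        k ^ d * (312 * (k * L) / m) := fun i => by
    simp only [marg_family hk, marg_parents hk, estFactor]
    rw [sum_eq_sum_familyEvent hk P (hd i) fun a σ =>
      prob P (FamilyEvent G i a σ) / prob P (ParentEvent G i a) /
        ((estNum G L m ω i a σ : ℝ) / estDen G L m ω i a) - 1]
    refine (Finset.sum_le_sum fun a ha => h.chiSq_le hk hL hm i ha).trans (le_of_eq ?_)
    simp
  refine (Finset.sum_le_sum fun i _ => key i).trans (le_of_eq ?_)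
  simp
  ring

/-- Union bound over n k^d (k + 1) events, each failing with probability at most 2 exp(-L), together
with k + 1 ≤ 2k. -/
theorem sampleLaw_not_allClose_le (G : Digraph (Fin n)) (d : ℕ) {L : ℕ} (hk : 0 < k) (hL : 0 < L)
    (m : ℕ) (P : PMF (Fin n → Fin k)) :
    (sampleLaw P).real {ω | ¬ AllClose G d L m P ω} ≤
      4 * ((k : ℝ) ^ (d + 1) * n) * Real.exp (-L) := by
  have hL' : (0 : ℝ) < L := Nat.cast_pos.2 hL
  have : IsProbabilityMeasure (sampleLaw P) := by unfold sampleLaw; infer_instance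
  have hB := fun E => measureReal_not_countClose_le P E m hL'
  let B : ((Fin n → Fin k) → Prop) → Set (ℕ → Fin n → Fin k) := fun E =>
    {ω | ¬ CountClose L (m * prob P E) (count E m ω)}
  have hsub : {ω | ¬ AllClose G d L m P ω} ⊆
      ⋃ i ∈ (Finset.univ : Finset (Fin n)), ⋃ a ∈ Finset.range (k ^ d),
        (B (ParentEvent G i a) ∪
          ⋃ σ ∈ (Finset.univ : Finset (Fin k)), B (FamilyEvent G i a σ)) := by
    intro ω hω
    by_contra hn
    simp only [Set.mem_iUnion, Set.mem_union, not_exists, not_or, B, Set.mem_ofPred_eq,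
      not_not] at hn
    exact hω fun i a ha => ⟨(hn i (Finset.mem_univ i) a ha).1,
      fun σ => (hn i (Finset.mem_univ i) a ha).2 σ (Finset.mem_univ σ)⟩
  have h1 : ∀ i a, (sampleLaw P).real (B (ParentEvent G i a) ∪
      ⋃ σ ∈ (Finset.univ : Finset (Fin k)), B (FamilyEvent G i a σ)) ≤
        2 * Real.exp (-L) + k * (2 * Real.exp (-L)) := fun i a => by
    refine (measureReal_union_le _ _).trans (add_le_add (hB _) ?_)
    refine (measureReal_biUnion_finset_le _ _).trans
      ((Finset.sum_le_sum fun σ _ => hB _).trans (le_of_eq ?_))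
    simp
  have h2 : ∀ i, (sampleLaw P).real (⋃ a ∈ Finset.range (k ^ d), (B (ParentEvent G i a) ∪
      ⋃ σ ∈ (Finset.univ : Finset (Fin k)), B (FamilyEvent G i a σ))) ≤
        k ^ d * (2 * Real.exp (-L) + k * (2 * Real.exp (-L))) := fun i =>
    (measureReal_biUnion_finset_le _ _).trans
      ((Finset.sum_le_sum fun a _ => h1 i a).trans (le_of_eq (by simp [mul_add])))
  refine (measureReal_mono hsub (measure_ne_top _ _)).trans ((measureReal_biUnion_finset_le _ _).trans
    ((Finset.sum_le_sum fun i _ => h2 i).trans ?_))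
  simp only [Finset.sum_const, Finset.card_univ, Fintype.card_fin, nsmul_eq_mul]
  have hk1 : (1 : ℝ) ≤ k := by exact_mod_cast hk
  have h3 : 0 ≤ (n : ℝ) * k ^ d * (2 * Real.exp (-L)) := by positivity
  rw [pow_succ]
  nlinarith

end

/-! ### Reasoning about programs -/

section

variable {s : Config} {ω : ℕ → ℕ → ℕ}

theorem Config.reg_setReg (s : Config) (r v q : ℕ) :
    (s.setReg r v).reg q = if q = r then v else s.reg q := by
  simp [Config.setReg, Function.update_apply]

theorem Config.reg_setReg_of_lt (s : Config) {r v q b : ℕ} (hq : q < b) (hb : b ≤ r) :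
    (s.setReg r v).reg q = s.reg q := by
  rw [Config.reg_setReg, if_neg (by omega)]

theorem Config.arr_setReg (s : Config) (r v : ℕ) : (s.setReg r v).arr = s.arr := rfl

theorem Config.draws_setReg (s : Config) (r v : ℕ) : (s.setReg r v).draws = s.draws := rfl

theorem Config.reg_setArr (s : Config) (t c v : ℕ) : (s.setArr t c v).reg = s.reg := rfl

theorem Config.arr_setArr (s : Config) (t c v t' c' : ℕ) :
    (s.setArr t c v).arr t' c' = if t' = t ∧ c' = c then v else s.arr t' c' := by
  by_cases h : t' = t
  · subst h
    simp [Config.setArr, Function.update_apply]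
  · simp [Config.setArr, h]

/-- Started in `s`, the program `p` halts within `B` steps in a configuration that satisfies `Q`. -/
def Runs (ω : ℕ → ℕ → ℕ) (p : Prog) (s : Config) (B : ℕ) (Q : Config → Prop) : Prop :=
  ∃ s' T, Exec ω p s s' T ∧ T ≤ B ∧ Q s'

/-- Sequential composition of a list of programs. -/
def Prog.block (l : List Prog) : Prog := l.foldr Prog.seq Prog.skip

theorem Runs.mono {p : Prog} {B B' : ℕ} {Q Q' : Config → Prop} (h : Runs ω p s B Q) (hB : B ≤ B')
    (hQ : ∀ s', Q s' → Q' s') : Runs ω p s B' Q' := by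
  obtain ⟨s', T, he, hT, hs⟩ := h
  exact ⟨s', T, he, hT.trans hB, hQ s' hs⟩

theorem Runs.nil {Q : Config → Prop} (h : Q s) : Runs ω (Prog.block []) s 1 Q :=
  ⟨s, 1, Exec.skip s, le_rfl, h⟩

theorem Runs.cons {p : Prog} {l : List Prog} {B B' : ℕ} {R Q : Config → Prop}
    (h : Runs ω p s B R) (h' : ∀ s', R s' → Runs ω (Prog.block l) s' B' Q) :
    Runs ω (Prog.block (p :: l)) s (B + B') Q := by
  obtain ⟨s₁, T₁, he₁, hT₁, hs₁⟩ := h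
  obtain ⟨s₂, T₂, he₂, hT₂, hs₂⟩ := h' s₁ hs₁
  exact ⟨s₂, T₁ + T₂, Exec.seq he₁ he₂, by omega, hs₂⟩

theorem Runs.step {p : Prog} {l : List Prog} {B : ℕ} {s' : Config} {Q : Config → Prop}
    (h : Exec ω p s s' 1) (h' : Runs ω (Prog.block l) s' B Q) :
    Runs ω (Prog.block (p :: l)) s (1 + B) Q :=
  Runs.cons (R := fun x => x = s') ⟨s', 1, h, le_rfl, rfl⟩ fun _ hx => hx ▸ h'

/-- A loop with invariant `I` that makes `N` iterations. -/
theorem Runs.loop {a b : ℕ} {p : Prog} (I : ℕ → Config → Prop) (N B : ℕ) (h0 : I 0 s)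
    (hstep : ∀ j < N, ∀ s, I j s → s.reg a < s.reg b ∧ Runs ω p s B (I (j + 1)))
    (hend : ∀ s, I N s → ¬ s.reg a < s.reg b) :
    Runs ω (Prog.loop a b p) s (N * (B + 1) + 1) (I N) := by
  induction N generalizing s I with
  | zero => exact ⟨s, 1, Exec.loop_done (hend s h0), by omega, h0⟩
  | succ N ih =>
    obtain ⟨hlt, s₁, T₁, he₁, hT₁, hs₁⟩ := hstep 0 (Nat.succ_pos N) s h0
    obtain ⟨s₂, T₂, he₂, hT₂, hs₂⟩ := ih (fun j => I (j + 1)) hs₁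
      (fun j hj => hstep (j + 1) (by omega)) hend
    refine ⟨s₂, T₁ + T₂ + 1, Exec.loop_step hlt he₁ he₂, ?_, hs₂⟩
    rw [Nat.succ_mul]
    omega

/-! ### Arithmetic subroutines

Register `7` holds the constant `1` and register `8` the constant `0`. -/

/-- `R[r] := R[x] * R[y]`, using register `30`. -/
def mulProg (r x y : ℕ) : Prog :=
  .block [.const r 0, .const 30 0, .loop 30 y (.block [.add r r x, .add 30 30 7])]

/-- The time depends on the second factor only, so callers put there the factor whose size is under
control; the first may be a denominator of unbounded size. -/
theorem runs_mulProg {r x y a b : ℕ} (hr : r ≠ x ∧ r ≠ y ∧ r ≠ 7 ∧ r ≠ 30)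
    (hxy : x ≠ 30 ∧ y ≠ 30) (h7 : s.reg 7 = 1) (hx : s.reg x = a) (hy : s.reg y = b) :
    Runs ω (mulProg r x y) s (4 * b + 4) fun s' =>
      s'.reg r = a * b ∧ (∀ q, q ≠ r → q ≠ 30 → s'.reg q = s.reg q) ∧ s'.arr = s.arr ∧
        s'.draws = s.draws := by
  obtain ⟨hrx, hry, hr7, hr30⟩ := hr
  obtain ⟨hx30, hy30⟩ := hxy
  refine Runs.mono (Runs.step (.const _ _ _) (Runs.step (.const _ _ _) (Runs.cons
    (Runs.loop (fun j s' => s'.reg r = a * j ∧ s'.reg 30 = j ∧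
      (∀ q, q ≠ r → q ≠ 30 → s'.reg q = s.reg q) ∧ s'.arr = s.arr ∧
        s'.draws = s.draws) b 3 ?_ ?_ ?_) fun s' hs' => Runs.nil hs')))
    (by omega) fun s' h => ⟨h.1, h.2.2⟩
  · refine ⟨?_, ?_, ?_, rfl, rfl⟩
    · simp [Config.reg_setReg, hr30]
    · simp [Config.reg_setReg]
    · intro q h1 h2
      simp [Config.reg_setReg, h1, h2]
  · rintro j hj s' ⟨h1, h2, h3, h4, h5⟩
    refine ⟨by rw [h2, h3 y hry.symm hy30, hy]; exact hj, ?_⟩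
    refine Runs.step (.add _ _ _ _) (Runs.step (.add _ _ _ _) (Runs.nil ⟨?_, ?_, ?_, h4, h5⟩))
    · simp [Config.reg_setReg, hr30, h1, h3 x hrx.symm hx30, hx, mul_add]
    · simp [Config.reg_setReg, hr30.symm, hr7.symm, h2, h3 7 hr7.symm (by decide), h7]
    · intro q h6 h7
      simp [Config.reg_setReg, h6, h7, h3 q h6 h7]
  · rintro s' ⟨-, h2, h3, -⟩
    rw [h2, h3 y hry.symm hy30, hy]
    exact lt_irrefl b

/-- The least `j` with `q ≤ j * p`. -/
noncomputable def invCeil (p q : ℕ) : ℕ := sInf {j | q ≤ j * p}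

/-- The least `j` with `q ≤ p * 2 ^ j`. -/
noncomputable def logCeil (p q : ℕ) : ℕ := sInf {j | q ≤ p * 2 ^ j}

theorem le_invCeil_mul {p : ℕ} (hp : 0 < p) (q : ℕ) : q ≤ invCeil p q * p :=
  Nat.sInf_mem (s := {j | q ≤ j * p}) ⟨q, Nat.le_mul_of_pos_right q hp⟩

theorem mul_lt_of_lt_invCeil {p q j : ℕ} (h : j < invCeil p q) : j * p < q :=
  not_le.1 (Nat.notMem_of_lt_sInf (s := {j | q ≤ j * p}) h)

theorem le_mul_two_pow_logCeil {p : ℕ} (hp : 0 < p) (q : ℕ) : q ≤ p * 2 ^ logCeil p q :=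
  Nat.sInf_mem (s := {j | q ≤ p * 2 ^ j})
    ⟨q, Nat.lt_two_pow_self.le.trans (Nat.le_mul_of_pos_left _ hp)⟩

theorem mul_two_pow_lt_of_lt_logCeil {p q j : ℕ} (h : j < logCeil p q) : p * 2 ^ j < q :=
  not_le.1 (Nat.notMem_of_lt_sInf (s := {j | q ≤ p * 2 ^ j}) h)

/-- `R[9] := ⌈R[4] / R[3]⌉`. -/
def invProg : Prog :=
  .block [.const 9 0, .const 20 0, .loop 20 4 (.block [.add 20 20 3, .add 9 9 7])]

/-- Multiples of p are accumulated until they reach q, so the time is proportional to the quotient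
and not to p or q. -/
theorem runs_invProg {p q : ℕ} (hp : 0 < p) (h7 : s.reg 7 = 1) (h3 : s.reg 3 = p)
    (h4 : s.reg 4 = q) :
    Runs ω invProg s (4 * invCeil p q + 4) fun s' => s'.reg 9 = invCeil p q ∧
      (∀ r, r ≠ 9 → r < 20 → s'.reg r = s.reg r) ∧ s'.arr = s.arr ∧ s'.draws = s.draws := by
  refine Runs.mono (Runs.step (.const _ _ _) (Runs.step (.const _ _ _) (Runs.cons
    (Runs.loop (fun j s' => s'.reg 9 = j ∧ s'.reg 20 = j * p ∧
      (∀ r, r ≠ 9 → r < 20 → s'.reg r = s.reg r) ∧ s'.arr = s.arr ∧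
        s'.draws = s.draws) (invCeil p q) 3 ?_ ?_ ?_) fun s' hs' => Runs.nil hs')))
    (by omega) fun s' h => ⟨h.1, h.2.2⟩
  · refine ⟨by simp [Config.reg_setReg], by simp [Config.reg_setReg], ?_, rfl, rfl⟩
    intro r h1 h2
    simp [Config.reg_setReg, h1, h2.ne]
  · rintro j hj s' ⟨h1, h2, h5, h6, h8⟩
    refine ⟨by rw [h2, h5 4 (by decide) (by decide), h4]; exact mul_lt_of_lt_invCeil hj, ?_⟩
    refine Runs.step (.add _ _ _ _) (Runs.step (.add _ _ _ _) (Runs.nil ⟨?_, ?_, ?_, h6, h8⟩))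
    · simp [Config.reg_setReg, h1, h5, h7]
    · simp [Config.reg_setReg, h2, h5, h3, add_mul]
    · intro r h9 h10
      simp [Config.reg_setReg, h9, h10.ne, h5 r h9 h10]
  · rintro s' ⟨-, h2, h5, -⟩
    rw [h2, h5 4 (by decide) (by decide), h4]
    exact not_lt.2 (le_invCeil_mul hp q)

/-- `R[11] := R[1] ^ R[2]`. -/
def powProg : Prog :=
  .block [.const 11 1, .const 20 0,
    .loop 20 2 (.block [mulProg 21 11 1, .add 11 21 8, .add 20 20 7])]

theorem runs_powProg {k d : ℕ} (h7 : s.reg 7 = 1) (h8 : s.reg 8 = 0) (h1 : s.reg 1 = k)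
    (h2 : s.reg 2 = d) :
    Runs ω powProg s (d * (4 * k + 8) + 4) fun s' => s'.reg 11 = k ^ d ∧
      (∀ r, r ≠ 11 → r < 20 → s'.reg r = s.reg r) ∧ s'.arr = s.arr ∧ s'.draws = s.draws := by
  refine Runs.mono (Runs.step (.const _ _ _) (Runs.step (.const _ _ _) (Runs.cons
    (Runs.loop (fun j s' => s'.reg 11 = k ^ j ∧ s'.reg 20 = j ∧
      (∀ r, r ≠ 11 → r < 20 → s'.reg r = s.reg r) ∧ s'.arr = s.arr ∧
        s'.draws = s.draws) d (4 * k + 4 + 3) ?_ ?_ ?_) fun s' hs' => Runs.nil hs')))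
    (le_of_eq (by ring)) fun s' h => ⟨h.1, h.2.2⟩
  · refine ⟨by simp [Config.reg_setReg], by simp [Config.reg_setReg], ?_, rfl, rfl⟩
    intro r h1 h2
    simp [Config.reg_setReg, h1, h2.ne]
  · rintro j hj s' ⟨e1, e2, hf, ha, hd⟩
    refine ⟨by rw [e2, hf 2 (by decide) (by decide), h2]; exact hj, ?_⟩
    refine Runs.cons (runs_mulProg (a := k ^ j) (b := k) (by decide) (by decide)
      (by simp [hf, h7]) e1 (by simp [hf, h1])) ?_
    rintro s1 ⟨g1, gf, ga, gd⟩
    refine Runs.step (.add _ _ _ _) (Runs.step (.add _ _ _ _) (Runs.nil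
      ⟨?_, ?_, ?_, ga.trans ha, gd.trans hd⟩))
    -- Register 8 is 0, so the addition copies the product back; `mulProg` needs a target distinct
    -- from its factors.
    · simp [Config.reg_setReg, g1, gf, hf, h8, pow_succ]
    · simp [Config.reg_setReg, gf, e2, hf, h7]
    · intro r h9 h10
      simp [Config.reg_setReg, h9, h10.ne, gf r (by omega) (by omega), hf r h9 h10]
  · rintro s' ⟨-, e2, hf, -⟩
    rw [e2, hf 2 (by decide) (by decide), h2]
    exact lt_irrefl d

/-- `R[14] :=` the least `j` with `R[22] ≤ R[5] * 2 ^ j`. -/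
def logProg : Prog :=
  .block [.const 14 0, .add 23 5 8, .loop 23 22 (.block [.add 23 23 23, .add 14 14 7])]

theorem runs_logProg {p q : ℕ} (hp : 0 < p) (h7 : s.reg 7 = 1) (h8 : s.reg 8 = 0)
    (h5 : s.reg 5 = p) (h22 : s.reg 22 = q) :
    Runs ω logProg s (4 * logCeil p q + 4) fun s' => s'.reg 14 = logCeil p q ∧
      (∀ r, r ≠ 14 → r < 20 → s'.reg r = s.reg r) ∧ s'.arr = s.arr ∧ s'.draws = s.draws := by
  refine Runs.mono (Runs.step (.const _ _ _) (Runs.step (.add _ _ _ _) (Runs.cons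
    -- The invariant protects registers up to 22, since register 22 is the bound of the loop.
    (Runs.loop (fun j s' => s'.reg 14 = j ∧ s'.reg 23 = p * 2 ^ j ∧
      (∀ r, r ≠ 14 → r < 23 → s'.reg r = s.reg r) ∧ s'.arr = s.arr ∧
        s'.draws = s.draws) (logCeil p q) 3 ?_ ?_ ?_) fun s' hs' => Runs.nil hs')))
    (by omega) fun s' h => ⟨h.1, fun r h1 h2 => h.2.2.1 r h1 (by omega), h.2.2.2⟩
  · refine ⟨by simp [Config.reg_setReg], by simp [Config.reg_setReg, h5, h8], ?_, rfl, rfl⟩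
    intro r h1 h2
    simp [Config.reg_setReg, h1, h2.ne]
  · rintro j hj s' ⟨e1, e2, hf, ha, hd⟩
    refine ⟨by rw [e2, hf 22 (by decide) (by decide), h22]
               exact mul_two_pow_lt_of_lt_logCeil hj, ?_⟩
    refine Runs.step (.add _ _ _ _) (Runs.step (.add _ _ _ _) (Runs.nil ⟨?_, ?_, ?_, ha, hd⟩))
    · simp [Config.reg_setReg, e1, hf, h7]
    · simp [Config.reg_setReg, e2, pow_succ]
      ring
    · intro r h9 h10
      simp [Config.reg_setReg, h9, h10.ne, hf r h9 h10]
  · rintro s' ⟨-, e2, hf, -⟩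
    rw [e2, hf 22 (by decide) (by decide), h22]
    exact not_lt.2 (le_mul_two_pow_logCeil hp q)

/-! ### The learning program: parameters -/

/-- The sample size of the learner. -/
def sampleSize (N L A : ℕ) : ℕ := N * L * (A * A) * 312

/-- Compute `R[11] = k ^ d`, `R[12] = n k ^ d`, `R[13] = n k ^ (d + 1)`, the logarithmic factor
`R[14]`, the sample size `R[15]`, and the initial values `R[16]` and `R[17]` of the table entries
and of their denominators. -/
def paramProg : Prog :=
  .block [.const 7 1, .const 8 0, invProg, powProg, mulProg 12 11 0, mulProg 13 12 1,
    .add 21 13 13, .add 21 21 21, mulProg 22 6 21, logProg,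
    mulProg 24 13 14, mulProg 25 9 9, mulProg 26 24 25, .const 27 312, mulProg 15 26 27,
    .add 16 14 14, .add 16 16 14, mulProg 17 16 1]

theorem runs_paramProg {n k d p q p' q' A N L : ℕ} (hp : 0 < p) (hp' : 0 < p')
    (h0 : s.reg 0 = n) (h1 : s.reg 1 = k) (h2 : s.reg 2 = d) (h3 : s.reg 3 = p) (h4 : s.reg 4 = q)
    (h5 : s.reg 5 = p') (h6 : s.reg 6 = q') (hA : A = invCeil p q) (hN : N = k ^ d * n * k)
    (hL : L = logCeil p' (q' * (N + N + (N + N)))) :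
    Runs ω paramProg s (8 * A + 4 * A * A + d * (4 * k + 8) + 4 * n + 8 * k + 16 * N + 8 * L + 1400)
      fun s' => s'.reg 0 = n ∧ s'.reg 1 = k ∧ s'.reg 2 = d ∧ s'.reg 7 = 1 ∧ s'.reg 8 = 0 ∧
        s'.reg 11 = k ^ d ∧ s'.reg 12 = k ^ d * n ∧ s'.reg 13 = N ∧ s'.reg 15 = sampleSize N L A ∧
        s'.reg 16 = 3 * L ∧ s'.reg 17 = 3 * L * k ∧ s'.arr = s.arr ∧ s'.draws = s.draws := by
  refine Runs.mono (Runs.step (.const _ _ _) (Runs.step (.const _ _ _) ?_))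
    (B := 1 + (1 + (4 * A + 4 + (d * (4 * k + 8) + 4 + (4 * n + 4 + (4 * k + 4 + (1 + (1 +
      (4 * (N + N + (N + N)) + 4 + (4 * L + 4 + (4 * L + 4 + (4 * A + 4 + (4 * (A * A) + 4 + (1 +
        (4 * 312 + 4 + (1 + (1 + (4 * k + 4 + 1)))))))))))))))))) ?_ fun _ h => h
  swap
  · rw [mul_assoc 4 A A]; omega
  refine Runs.cons (hA ▸ runs_invProg hp (by simp [Config.reg_setReg])
    (by simp [Config.reg_setReg, h3]) (by simp [Config.reg_setReg, h4])) ?_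
  rintro s1 ⟨a9, af, aa, ad⟩
  refine Runs.cons (runs_powProg (k := k) (d := d) (by simp [af, Config.reg_setReg])
    (by simp [af, Config.reg_setReg]) (by simp [af, Config.reg_setReg, h1])
    (by simp [af, Config.reg_setReg, h2])) ?_
  rintro s2 ⟨b11, bf, ba, bd⟩
  have b9 : s2.reg 9 = A := by simp [bf, a9]
  have b0 : s2.reg 0 = n ∧ s2.reg 1 = k ∧ s2.reg 2 = d ∧ s2.reg 5 = p' ∧ s2.reg 6 = q' ∧
      s2.reg 7 = 1 ∧ s2.reg 8 = 0 := by
    simp [bf, af, Config.reg_setReg, h0, h1, h2, h5, h6]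
  have bA : s2.arr = s.arr := ba.trans aa
  have bD : s2.draws = s.draws := bd.trans ad
  clear ba bd aa ad af a9 bf s1
  obtain ⟨b0, b1, b2, b5, b6, b7, b8⟩ := b0
  refine Runs.cons (runs_mulProg (by decide) (by decide) b7 b11 b0) ?_
  rintro s3 ⟨c12, cf, ca, cd⟩
  refine Runs.cons (runs_mulProg (b := k) (by decide) (by decide) (by simp [cf, b7]) c12
    (by simp [cf, b1])) ?_
  rintro s4 ⟨d13, df, da, dd⟩
  rw [← hN] at d13
  -- Two additions form 4N, the constant in front of exp(-L) in the union bound.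
  refine Runs.step (.add _ _ _ _) (Runs.step (.add _ _ _ _) (Runs.cons
    (runs_mulProg (a := q') (b := N + N + (N + N)) (by decide) (by decide)
    (by simp [Config.reg_setReg, df, cf, b7]) (by simp [Config.reg_setReg, df, cf, b6])
    (by simp [Config.reg_setReg, d13])) ?_))
  rintro s5 ⟨e22, ef, ea, ed⟩
  refine Runs.cons (hL ▸ runs_logProg hp' (by simp [ef, Config.reg_setReg, df, cf, b7])
    (by simp [ef, Config.reg_setReg, df, cf, b8]) (by simp [ef, Config.reg_setReg, df, cf, b5])
    e22) ?_
  rintro s6 ⟨f14, ff, fa, fd⟩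
  have f0 : s6.reg 0 = n ∧ s6.reg 1 = k ∧ s6.reg 2 = d ∧ s6.reg 7 = 1 ∧ s6.reg 8 = 0 ∧
      s6.reg 9 = A ∧ s6.reg 11 = k ^ d ∧ s6.reg 12 = k ^ d * n ∧ s6.reg 13 = N := by
    simp [ff, ef, df, cf, Config.reg_setReg, b0, b1, b2, b7, b8, b9, b11, c12, d13]
  have fA : s6.arr = s.arr :=
    fa.trans (ea.trans (da.trans (ca.trans bA)))
  have fD : s6.draws = s.draws :=
    fd.trans (ed.trans (dd.trans (cd.trans bD)))
  clear fa fd ea ed da dd ca cd bA bD ff ef df cf b0 b1 b2 b5 b6 b7 b8 b9 b11 c12 d13 e22 s5 s4 s3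
  obtain ⟨f0, f1, f2, f7, f8, f9, f11, f12, f13⟩ := f0
  refine Runs.cons (runs_mulProg (by decide) (by decide) f7 f13 f14) ?_
  rintro s7 ⟨g24, gf, ga, gd⟩
  refine Runs.cons (runs_mulProg (a := A) (b := A) (by decide) (by decide) (by simp [gf, f7])
    (by simp [gf, f9]) (by simp [gf, f9])) ?_
  rintro s8 ⟨i25, hf, ha, hd⟩
  refine Runs.cons (runs_mulProg (a := N * L) (by decide) (by decide) (by simp [hf, gf, f7])
    (by simp [hf, g24]) i25) ?_
  rintro s9 ⟨i26, jf, ja, jd⟩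
  refine Runs.step (.const _ _ _) (Runs.cons (runs_mulProg (a := N * L * (A * A)) (b := 312)
    (by decide) (by decide) (by simp [Config.reg_setReg, jf, hf, gf, f7])
    (by simp [Config.reg_setReg, i26]) (by simp [Config.reg_setReg])) ?_)
  rintro s10 ⟨l15, kf, ka, kd⟩
  refine Runs.step (.add _ _ _ _) (Runs.step (.add _ _ _ _) (Runs.cons (runs_mulProg (a := 3 * L)
    (b := k) (by decide) (by decide) (by simp [Config.reg_setReg, kf, jf, hf, gf, f7])
    (by simp [Config.reg_setReg, kf, jf, hf, gf, f14]; ring)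
    (by simp [Config.reg_setReg, kf, jf, hf, gf, f1])) ?_))
  rintro s11 ⟨m17, mf, ma, md⟩
  refine Runs.nil ?_
  have hA' : s11.arr = s.arr :=
    ma.trans (ka.trans (ja.trans (ha.trans (ga.trans fA))))
  have hD' : s11.draws = s.draws :=
    md.trans (kd.trans (jd.trans (hd.trans (gd.trans fD))))
  simp [mf, kf, jf, hf, gf, Config.reg_setReg, f0, f1, f2, f7, f8, f11, f12, f13, f14, m17, l15,
    hA', hD', sampleSize]
  ring

end

section

variable {s : Config} {ω : ℕ → ℕ → ℕ}

/-! ### The learning program: tables -/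

/-- Initialize the tables. -/
def initProg : Prog :=
  .block [.const 20 0, .loop 20 12 (.block [.store 3 20 17, .add 20 20 7]),
    .const 20 0, .loop 20 13 (.block [.store 2 20 16, .add 20 20 7])]

theorem runs_fill {t r x c N : ℕ} (hr : r < 20) (hx : x < 20) (h7 : s.reg 7 = 1)
    (h20 : s.reg 20 = 0) (hN : s.reg r = N) (hc : s.reg x = c) :
    Runs ω (.loop 20 r (.block [.store t 20 x, .add 20 20 7])) s (N * 4 + 1) fun s' =>
      (∀ a < N, s'.arr t a = c) ∧ (∀ t', t' ≠ t → s'.arr t' = s.arr t') ∧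
        (∀ q < 20, s'.reg q = s.reg q) ∧ s'.draws = s.draws := by
  refine Runs.mono (Runs.loop (fun j s' => s'.reg 20 = j ∧ (∀ a < j, s'.arr t a = c) ∧
    (∀ t', t' ≠ t → s'.arr t' = s.arr t') ∧ (∀ q < 20, s'.reg q = s.reg q) ∧
      s'.draws = s.draws) N 3 ?_ ?_ ?_) le_rfl fun s' h => h.2
  · exact ⟨h20, fun a ha => absurd ha (Nat.not_lt_zero a), fun _ _ => rfl, fun _ _ => rfl, rfl⟩
  · rintro j hj s' ⟨e1, e2, e3, e4, e5⟩
    refine ⟨by rw [e1, e4 r hr, hN]; exact hj, ?_⟩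
    refine Runs.step (.store _ _ _ _) (Runs.step (.add _ _ _ _) (Runs.nil ⟨?_, ?_, ?_, ?_, e5⟩))
    · simp [Config.reg_setReg, Config.reg_setArr, e1, e4, h7]
    · intro a ha
      rw [Config.arr_setReg, Config.arr_setArr, e1, e4 x hx, hc]
      split_ifs with h
      · rfl
      · exact e2 a (by simp at h; omega)
    · intro t' ht'
      funext a
      rw [Config.arr_setReg, Config.arr_setArr, if_neg fun h => ht' h.1, e3 t' ht']
    · intro q hq
      rw [Config.reg_setReg, if_neg hq.ne, Config.reg_setArr, e4 q hq]
  · rintro s' ⟨e1, -, -, e4, -⟩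
    rw [e1, e4 r hr, hN]
    exact lt_irrefl N

theorem runs_initProg {D N a b : ℕ} (h7 : s.reg 7 = 1) (h12 : s.reg 12 = D) (h13 : s.reg 13 = N)
    (h16 : s.reg 16 = a) (h17 : s.reg 17 = b) :
    Runs ω initProg s (4 * D + 4 * N + 5) fun s' =>
      (∀ c < D, s'.arr 3 c = b) ∧ (∀ c < N, s'.arr 2 c = a) ∧ s'.arr 0 = s.arr 0 ∧
        s'.arr 1 = s.arr 1 ∧ (∀ q < 20, s'.reg q = s.reg q) ∧ s'.draws = s.draws := by
  refine Runs.mono (Runs.step (.const _ _ _) (Runs.cons (runs_fill (N := D) (c := b) (by decide)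
    (by decide) (by simp [Config.reg_setReg, h7]) (by simp [Config.reg_setReg])
    (by simp [Config.reg_setReg, h12]) (by simp [Config.reg_setReg, h17])) ?_))
    (B := 1 + (D * 4 + 1 + (1 + (N * 4 + 1 + 1)))) (by omega) fun _ h => h
  rintro s1 ⟨a1, a2, a3, a4⟩
  refine Runs.step (.const _ _ _) (Runs.cons (runs_fill (N := N) (c := a) (by decide)
    (by decide) (by simp [Config.reg_setReg, a3, h7]) (by simp [Config.reg_setReg])
    (by simp [Config.reg_setReg, a3, h13]) (by simp [Config.reg_setReg, a3, h16])) ?_)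
  rintro s2 ⟨b1, b2, b3, b4⟩
  refine Runs.nil ⟨fun c hc => ?_, b1, ?_, ?_, fun q hq => ?_, b4.trans a4⟩
  · rw [b2 3 (by decide), Config.arr_setReg, a1 c hc]
  · rw [b2 0 (by decide), Config.arr_setReg, a2 0 (by decide), Config.arr_setReg]
  · rw [b2 1 (by decide), Config.arr_setReg, a2 1 (by decide), Config.arr_setReg]
  · rw [b3 q hq, Config.reg_setReg, if_neg hq.ne, a3 q hq, Config.reg_setReg, if_neg hq.ne]

/-! ### The learning program: processing one vertex -/

/-- `R[23] :=` the code of the parent values of vertex `R[19]` in the current sample. -/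
def codeProg : Prog :=
  .block [.load 22 0 19, .const 23 0,
    .loop 8 22 (.block [.sub 22 22 7, .add 24 20 22, .load 25 1 24, .read 26 25,
      mulProg 27 23 1, .add 23 27 26])]

/-- Horner's rule, run from the last parent down to the first because the first parent is the least
significant digit. After j rounds the accumulator codes the last j parents. -/
theorem runs_codeProg {k d i t b : ℕ} {l : List ℕ} (h1 : s.reg 1 = k) (h7 : s.reg 7 = 1)
    (h8 : s.reg 8 = 0) (h19 : s.reg 19 = i) (h20 : s.reg 20 = b) (hl : l.length ≤ d)
    (h_len : s.arr 0 i = l.length) (h_list : ∀ j (hj : j < l.length), s.arr 1 (b + j) = l[j])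
    (ht : s.draws = t + 1) :
    Runs ω codeProg s (d * (4 * k + 11) + 4) fun s' =>
      s'.reg 23 = Nat.ofDigits k (l.map (ω t)) ∧ (∀ q < 22, s'.reg q = s.reg q) ∧
        s'.arr = s.arr ∧ s'.draws = s.draws := by
  refine Runs.mono (Runs.step (.load _ _ _ _) (Runs.step (.const _ _ _) (Runs.cons
    (Runs.loop (fun j s' => s'.reg 22 = l.length - j ∧
      s'.reg 23 = Nat.ofDigits k ((l.drop (l.length - j)).map (ω t)) ∧
      (∀ q < 22, s'.reg q = s.reg q) ∧ s'.arr = s.arr ∧ s'.draws = s.draws)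
      l.length (1 + (1 + (1 + (1 + (4 * k + 4 + (1 + 1)))))) ?_ ?_ ?_)
    fun s' hs' => Runs.nil hs'))) ?_ fun s' h => ⟨?_, h.2.2⟩
  · refine ⟨by simp [Config.reg_setReg, h19, h_len], by simp [Config.reg_setReg], ?_, rfl, rfl⟩
    intro q hq
    simp [Config.reg_setReg_of_lt _ hq]
  · rintro j hj s' ⟨e1, e2, hf, ha, hd⟩
    refine ⟨by rw [e1, hf 8 (by decide), h8]; omega, ?_⟩
    have hj' : l.length - (j + 1) < l.length := by omega
    refine Runs.step (.sub _ _ _ _) (Runs.step (.add _ _ _ _) (Runs.step (.load _ _ _ _)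
      (Runs.step (.read _ _ _) (Runs.cons (runs_mulProg (b := k) (by decide) (by decide)
        (by simp [Config.reg_setReg, hf, h7]) (by simpa [Config.reg_setReg] using e2)
        (by simp [Config.reg_setReg, hf, h1])) ?_))))
    rintro s1 ⟨g1, gf, ga, gd⟩
    refine Runs.step (.add _ _ _ _) (Runs.nil ⟨?_, ?_, ?_, ga.trans ha, gd.trans hd⟩)
    · simp [Config.reg_setReg, gf, e1, hf, h7]
      omega
    · have e3 : l.drop (l.length - (j + 1)) =
          l[l.length - (j + 1)] :: l.drop (l.length - j) := by
        rw [List.drop_eq_getElem_cons hj']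
        congr 2
        omega
      rw [e3, List.map_cons, Nat.ofDigits_cons, ← h_list _ hj']
      simp [Config.reg_setReg, Config.arr_setReg, Config.draws_setReg, gf, g1, e1, hf, h7, h20,
        hd, ht, ha, Nat.sub_sub]
      ring
    · intro q hq
      simp [Config.reg_setReg_of_lt _ hq, gf q (by omega) (by omega), hf q hq]
  · rintro s' ⟨e1, -, hf, -⟩
    rw [e1, hf 8 (by decide), h8]
    omega
  · have := Nat.mul_le_mul_right (4 * k + 11) hl
    calc _ = l.length * (4 * k + 11) + 4 := by ring
      _ ≤ _ := by omega
  · rw [h.2.1, Nat.sub_self, List.drop_zero]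

/-- Update the tables of vertex `R[19]` with the current sample. -/
def vertexProg : Prog :=
  .block [codeProg, .add 24 21 23, .load 25 3 24, .add 25 25 7, .store 3 24 25,
    mulProg 27 24 1, .read 26 19, .add 27 27 26, .load 25 2 27, .add 25 25 7, .store 2 27 25]

/-- The cell of the denominator table that a sample `x` increments. -/
def denCell (D k : ℕ) (l : ℕ → List ℕ) (x : ℕ → ℕ) (i : ℕ) : ℕ :=
  i * D + Nat.ofDigits k ((l i).map x)

/-- The cell of the numerator table that a sample `x` increments. -/
def numCell (D k : ℕ) (l : ℕ → List ℕ) (x : ℕ → ℕ) (i : ℕ) : ℕ :=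
  denCell D k l x i * k + x i

/-- The offsets i * d and i * D are supplied in registers and maintained by addition in the outer
loop. The only products left have k as second factor, which keeps the time per vertex of order dk.
-/
theorem runs_vertexProg {k d i t D : ℕ} {l : ℕ → List ℕ} (h1 : s.reg 1 = k) (h7 : s.reg 7 = 1)
    (h8 : s.reg 8 = 0) (h19 : s.reg 19 = i) (h20 : s.reg 20 = i * d) (h21 : s.reg 21 = i * D)
    (hl : (l i).length ≤ d) (h_len : s.arr 0 i = (l i).length)
    (h_list : ∀ j (hj : j < (l i).length), s.arr 1 (i * d + j) = (l i)[j])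
    (ht : s.draws = t + 1) :
    Runs ω vertexProg s (d * (4 * k + 11) + 4 * k + 18) fun s' =>
      (∀ c, s'.arr 3 c = s.arr 3 c + if denCell D k l (ω t) i = c then 1 else 0) ∧
        (∀ c, s'.arr 2 c = s.arr 2 c + if numCell D k l (ω t) i = c then 1 else 0) ∧
        s'.arr 0 = s.arr 0 ∧ s'.arr 1 = s.arr 1 ∧ (∀ q < 22, s'.reg q = s.reg q) ∧
        s'.draws = s.draws := by
  refine Runs.mono (Runs.cons (runs_codeProg h1 h7 h8 h19 h20 hl h_len h_list ht) ?_)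
    (B := d * (4 * k + 11) + 4 + (1 + (1 + (1 + (1 + (4 * k + 4 + (1 + (1 + (1 + (1 + (1 +
      1))))))))))) (by omega) fun _ h => h
  rintro s1 ⟨a23, af, aa, ad⟩
  have a24 : s1.reg 21 + s1.reg 23 = denCell D k l (ω t) i := by
    rw [a23, af 21 (by decide), h21, denCell]
  refine Runs.step (.add _ _ _ _) (Runs.step (.load _ _ _ _) (Runs.step (.add _ _ _ _)
    (Runs.step (.store _ _ _ _) (Runs.cons (runs_mulProg (a := denCell D k l (ω t) i) (b := k)
      (by decide) (by decide) (by simp [Config.reg_setReg, Config.reg_setArr, af, h7])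
      (by simp [Config.reg_setReg, Config.reg_setArr, a24])
      (by simp [Config.reg_setReg, Config.reg_setArr, af, h1])) ?_))))
  rintro s2 ⟨b27, bf, ba, bd⟩
  have b3 : ∀ t' c, s2.arr t' c =
      if t' = 3 ∧ c = denCell D k l (ω t) i then s.arr 3 c + 1 else s.arr t' c := by
    intro t' c
    rw [ba, Config.arr_setArr]
    simp only [Config.reg_setReg, Config.arr_setReg, aa, a24, af 7 (by decide), h7, if_true,
      show ¬ (24 : ℕ) = 25 by decide, show ¬ (7 : ℕ) = 25 by decide, show ¬ (7 : ℕ) = 24 by decide,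
      if_false]
    split_ifs with h
    · rw [h.2]
    · rfl
  have b0 : s2.draws = t + 1 ∧ (∀ q < 22, s2.reg q = s.reg q) := by
    refine ⟨(bd.trans ad).trans ht, fun q hq => ?_⟩
    simp [bf q (by omega) (by omega), Config.reg_setReg_of_lt _ hq, Config.reg_setArr, af q hq]
  clear ba bf a24 a23 aa af
  obtain ⟨bd, bf⟩ := b0
  have b26 : s2.reg 27 + ω t i = numCell D k l (ω t) i := by rw [b27, numCell]
  refine Runs.step (.read _ _ _) (Runs.step (.add _ _ _ _) (Runs.step (.load _ _ _ _)
    (Runs.step (.add _ _ _ _) (Runs.step (.store _ _ _ _) (Runs.nil ?_)))))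
  refine ⟨fun c => ?_, fun c => ?_, ?_, ?_, fun q hq => ?_, bd.trans ht.symm⟩
  · rw [Config.arr_setArr, if_neg fun h => by simp at h]
    simp only [Config.arr_setReg, b3, true_and, eq_comm (a := c)]
    split_ifs <;> rfl
  · rw [Config.arr_setArr]
    simp [Config.reg_setReg, Config.arr_setReg, bd, bf, h19, h7, b26, b3]
    by_cases h : c = numCell D k l (ω t) i
    · simp [h]
    · simp [h, Ne.symm h]
  · funext c
    rw [Config.arr_setArr, if_neg fun h => by simp at h]
    simp [Config.arr_setReg, b3]
  · funext c
    rw [Config.arr_setArr, if_neg fun h => by simp at h]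
    simp [Config.arr_setReg, b3]
  · simp [Config.reg_setReg_of_lt _ hq, Config.reg_setArr, bf q hq]

/-! ### The learning program: processing the samples -/

/-- Update all tables with the current sample. -/
def updateProg : Prog :=
  .block [.const 19 0, .const 20 0, .const 21 0,
    .loop 19 0 (.block [vertexProg, .add 19 19 7, .add 20 20 2, .add 21 21 11])]

theorem runs_updateProg {n k d t D : ℕ} {l : ℕ → List ℕ} (h0 : s.reg 0 = n) (h1 : s.reg 1 = k)
    (h2 : s.reg 2 = d) (h7 : s.reg 7 = 1) (h8 : s.reg 8 = 0) (h11 : s.reg 11 = D)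
    (hl : ∀ i < n, (l i).length ≤ d) (h_len : ∀ i < n, s.arr 0 i = (l i).length)
    (h_list : ∀ i < n, ∀ j (hj : j < (l i).length), s.arr 1 (i * d + j) = (l i)[j])
    (ht : s.draws = t + 1) :
    Runs ω updateProg s (n * (d * (4 * k + 11) + 4 * k + 23) + 5) fun s' =>
      (∀ c, s'.arr 3 c = s.arr 3 c +
        ∑ i ∈ Finset.range n, if denCell D k l (ω t) i = c then 1 else 0) ∧
      (∀ c, s'.arr 2 c = s.arr 2 c +
        ∑ i ∈ Finset.range n, if numCell D k l (ω t) i = c then 1 else 0) ∧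
      s'.arr 0 = s.arr 0 ∧ s'.arr 1 = s.arr 1 ∧ (∀ q < 19, s'.reg q = s.reg q) ∧
      s'.draws = s.draws := by
  refine Runs.mono (Runs.step (.const _ _ _) (Runs.step (.const _ _ _) (Runs.step (.const _ _ _)
    (Runs.cons (Runs.loop (fun i s' => (s'.reg 19 = i ∧ s'.reg 20 = i * d ∧ s'.reg 21 = i * D) ∧
      (∀ c, s'.arr 3 c = s.arr 3 c +
        ∑ i ∈ Finset.range i, if denCell D k l (ω t) i = c then 1 else 0) ∧
      (∀ c, s'.arr 2 c = s.arr 2 c +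
        ∑ i ∈ Finset.range i, if numCell D k l (ω t) i = c then 1 else 0) ∧
      s'.arr 0 = s.arr 0 ∧ s'.arr 1 = s.arr 1 ∧ (∀ q < 19, s'.reg q = s.reg q) ∧
      s'.draws = s.draws) n (d * (4 * k + 11) + 4 * k + 18 + (1 + (1 + (1 + 1)))) ?_ ?_ ?_)
    fun s' hs' => Runs.nil hs')))) (le_of_eq (by ring)) fun s' h => h.2
  · refine ⟨by simp [Config.reg_setReg], by simp [Config.arr_setReg], by simp [Config.arr_setReg],
      rfl, rfl, fun q hq => ?_, rfl⟩
    simp [Config.reg_setReg_of_lt _ hq]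
  · rintro i hi s' ⟨⟨e19, e20, e21⟩, e3, e2, e0, e1, ef, ed⟩
    refine ⟨by rw [e19, ef 0 (by decide), h0]; exact hi, ?_⟩
    refine Runs.cons (runs_vertexProg (i := i) (d := d) (D := D) (l := l) (k := k) (t := t)
      (by rw [ef 1 (by decide), h1]) (by rw [ef 7 (by decide), h7]) (by rw [ef 8 (by decide), h8])
      e19 e20 e21 (hl i hi) (by rw [e0, h_len i hi]) (fun j hj => by rw [e1, h_list i hi])
      (ed.trans ht)) ?_
    rintro s1 ⟨g3, g2, g0, g1, gf, gd⟩
    refine Runs.step (.add _ _ _ _) (Runs.step (.add _ _ _ _) (Runs.step (.add _ _ _ _)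
      (Runs.nil ⟨⟨?_, ?_, ?_⟩, fun c => ?_, fun c => ?_, g0.trans e0, g1.trans e1, fun q hq => ?_,
        gd.trans ed⟩)))
    · simp [Config.reg_setReg, gf, e19, ef, h7]
    · simp [Config.reg_setReg, gf, e20, ef, h2, add_mul]
    · simp [Config.reg_setReg, gf, e21, ef, h11, add_mul]
    · simp only [Config.arr_setReg]
      rw [g3, e3, Finset.sum_range_succ, add_assoc]
    · simp only [Config.arr_setReg]
      rw [g2, e2, Finset.sum_range_succ, add_assoc]
    · simp [Config.reg_setReg_of_lt _ hq, gf q (by omega), ef q hq]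
  · rintro s' ⟨⟨e19, -, -⟩, -, -, -, -, ef, -⟩
    rw [e19, ef 0 (by decide), h0]
    exact lt_irrefl n

/-- Draw `R[15]` samples and update all tables with each of them. -/
def sampleProg : Prog :=
  .block [.const 18 0, .loop 18 15 (.block [.draw, updateProg, .add 18 18 7])]

theorem runs_sampleProg {n k d m D : ℕ} {l : ℕ → List ℕ} (h0 : s.reg 0 = n) (h1 : s.reg 1 = k)
    (h2 : s.reg 2 = d) (h7 : s.reg 7 = 1) (h8 : s.reg 8 = 0) (h11 : s.reg 11 = D)
    (h15 : s.reg 15 = m)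
    (hl : ∀ i < n, (l i).length ≤ d) (h_len : ∀ i < n, s.arr 0 i = (l i).length)
    (h_list : ∀ i < n, ∀ j (hj : j < (l i).length), s.arr 1 (i * d + j) = (l i)[j])
    (hd : s.draws = 0) :
    Runs ω sampleProg s (m * (n * (d * (4 * k + 11) + 4 * k + 23) + 9) + 3) fun s' =>
      (∀ c, s'.arr 3 c = s.arr 3 c + ∑ t ∈ Finset.range m,
        ∑ i ∈ Finset.range n, if denCell D k l (ω t) i = c then 1 else 0) ∧
      (∀ c, s'.arr 2 c = s.arr 2 c + ∑ t ∈ Finset.range m,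
        ∑ i ∈ Finset.range n, if numCell D k l (ω t) i = c then 1 else 0) ∧
      s'.draws = m := by
  refine Runs.mono (Runs.step (.const _ _ _) (Runs.cons (Runs.loop (fun t s' => s'.reg 18 = t ∧
      (∀ c, s'.arr 3 c = s.arr 3 c + ∑ t ∈ Finset.range t,
        ∑ i ∈ Finset.range n, if denCell D k l (ω t) i = c then 1 else 0) ∧
      (∀ c, s'.arr 2 c = s.arr 2 c + ∑ t ∈ Finset.range t,
        ∑ i ∈ Finset.range n, if numCell D k l (ω t) i = c then 1 else 0) ∧
      s'.arr 0 = s.arr 0 ∧ s'.arr 1 = s.arr 1 ∧ (∀ q < 18, s'.reg q = s.reg q) ∧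
      s'.draws = t) m (1 + (n * (d * (4 * k + 11) + 4 * k + 23) + 5 + (1 + 1))) ?_ ?_ ?_)
    fun s' hs' => Runs.nil hs')) (le_of_eq (by ring)) fun s' h => ⟨h.2.1, h.2.2.1, h.2.2.2.2.2.2⟩
  · refine ⟨by simp [Config.reg_setReg], by simp [Config.arr_setReg], by simp [Config.arr_setReg],
      rfl, rfl, fun q hq => ?_, hd⟩
    simp [Config.reg_setReg, hq.ne]
  · rintro t ht s' ⟨e18, e3, e2, e0, e1, ef, ed⟩
    refine ⟨by rw [e18, ef 15 (by decide), h15]; exact ht, ?_⟩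
    -- After the draw the counter is t + 1, and reading uses the counter minus 1, that is, sample t.
    refine Runs.step (.draw _) (Runs.cons (runs_updateProg (n := n) (d := d) (D := D) (l := l)
      (k := k) (t := t) ((ef 0 (by decide)).trans h0) ((ef 1 (by decide)).trans h1)
      ((ef 2 (by decide)).trans h2) ((ef 7 (by decide)).trans h7) ((ef 8 (by decide)).trans h8)
      ((ef 11 (by decide)).trans h11) hl (fun i hi => by rw [← h_len i hi, ← e0])
      (fun i hi j hj => by rw [← h_list i hi j hj, ← e1]) (by rw [← ed])) ?_)
    rintro s1 ⟨g3, g2, g0, g1, gf, gd⟩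
    refine Runs.step (.add _ _ _ _) (Runs.nil ⟨?_, fun c => ?_, fun c => ?_, g0.trans e0,
      g1.trans e1, fun q hq => ?_, gd.trans (by rw [← ed])⟩)
    · simp [Config.reg_setReg, gf, e18, ef, h7]
    · simp only [Config.arr_setReg]
      rw [g3, e3, Finset.sum_range_succ, add_assoc]
    · simp only [Config.arr_setReg]
      rw [g2, e2, Finset.sum_range_succ, add_assoc]
    · rw [Config.reg_setReg, if_neg hq.ne, gf q (by omega), ef q hq]
  · rintro s' ⟨e18, -, -, -, -, ef, -⟩
    rw [e18, ef 15 (by decide), h15]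
    exact lt_irrefl m

/-- The learning program. -/
def learnProg : Prog := .block [paramProg, initProg, sampleProg]

theorem runs_learnProg {n k d p q p' q' A N L : ℕ} {l : ℕ → List ℕ} (hp : 0 < p) (hp' : 0 < p')
    (h0 : s.reg 0 = n) (h1 : s.reg 1 = k) (h2 : s.reg 2 = d) (h3 : s.reg 3 = p) (h4 : s.reg 4 = q)
    (h5 : s.reg 5 = p') (h6 : s.reg 6 = q') (hA : A = invCeil p q) (hN : N = k ^ d * n * k)
    (hL : L = logCeil p' (q' * (N + N + (N + N))))
    (hl : ∀ i < n, (l i).length ≤ d) (h_len : ∀ i < n, s.arr 0 i = (l i).length)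
    (h_list : ∀ i < n, ∀ j (hj : j < (l i).length), s.arr 1 (i * d + j) = (l i)[j])
    (hd : s.draws = 0) :
    Runs ω learnProg s (8 * A + 4 * A * A + d * (4 * k + 8) + 4 * n + 8 * k + 16 * N + 8 * L + 1400
        + (4 * (k ^ d * n) + 4 * N + 5
        + (sampleSize N L A * (n * (d * (4 * k + 11) + 4 * k + 23) + 9) + 3 + 1))) fun s' =>
      (∀ c < k ^ d * n, s'.arr 3 c = 3 * L * k + ∑ t ∈ Finset.range (sampleSize N L A),
        ∑ i ∈ Finset.range n, if denCell (k ^ d) k l (ω t) i = c then 1 else 0) ∧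
      (∀ c < N, s'.arr 2 c = 3 * L + ∑ t ∈ Finset.range (sampleSize N L A),
        ∑ i ∈ Finset.range n, if numCell (k ^ d) k l (ω t) i = c then 1 else 0) ∧
      s'.draws = sampleSize N L A := by
  refine Runs.cons (runs_paramProg hp hp' h0 h1 h2 h3 h4 h5 h6 hA hN hL) ?_
  rintro s1 ⟨a0, a1, a2, a7, a8, a11, a12, a13, a15, a16, a17, aa, ad⟩
  refine Runs.cons (runs_initProg a7 a12 a13 a16 a17) ?_
  rintro s2 ⟨b3, b2, b0, b1, bf, bd⟩
  refine Runs.cons (runs_sampleProg (n := n) (d := d) (D := k ^ d) (l := l)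
    (k := k) (m := sampleSize N L A) ((bf 0 (by decide)).trans a0) ((bf 1 (by decide)).trans a1)
      ((bf 2 (by decide)).trans a2) ((bf 7 (by decide)).trans a7) ((bf 8 (by decide)).trans a8)
      ((bf 11 (by decide)).trans a11) ((bf 15 (by decide)).trans a15) hl
      (fun i hi => by rw [b0, aa, h_len i hi]) (fun i hi j hj => by rw [b1, aa, h_list i hi j hj])
      (bd.trans (ad.trans hd))) ?_
  rintro s3 ⟨c3, c2, c0⟩
  exact Runs.nil ⟨fun c hc => by rw [c3, b3 c hc], fun c hc => by rw [c2, b2 c hc], c0⟩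

end

section

variable {n k : ℕ} {G : Digraph (Fin n)}

/-! ### The output of the learning program -/

/-- Uniqueness of quotient and remainder. Applied with D = k ^ d and D = k, it shows that table
cells do not collide. -/
theorem mul_add_eq_mul_add_iff {D i a i' a' : ℕ} (ha : a < D) (ha' : a' < D) :
    i * D + a = i' * D + a' ↔ i = i' ∧ a = a' := by
  constructor
  · intro h
    have hD : 0 < D := by omega
    have h1 := congrArg (· / D) h
    have h2 := congrArg (· % D) h
    simp only [Nat.mul_add_mod', Nat.mod_eq_of_lt ha, Nat.mod_eq_of_lt ha'] at h2
    simp only [add_comm _ a, add_comm _ a', Nat.add_mul_div_right _ _ hD, Nat.div_eq_of_lt ha,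
      Nat.div_eq_of_lt ha', zero_add] at h1
    exact ⟨h1, h2⟩
  · rintro ⟨rfl, rfl⟩
    rfl

/-- The parents of vertex number `i`, as natural numbers. -/
noncomputable def parentNums (G : Digraph (Fin n)) (i : ℕ) : List ℕ :=
  if h : i < n then (parentList G ⟨i, h⟩).map (fun v : Fin n => (v : ℕ)) else []

theorem parentNums_val (i : Fin n) :
    parentNums G i = (parentList G i).map (fun v : Fin n => (v : ℕ)) := by
  simp [parentNums]

theorem codeStream_val (ω : ℕ → Fin n → Fin k) (t : ℕ) (i : Fin n) :
    codeStream ω t i = (ω t i : ℕ) := by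
  simp [codeStream]

theorem denCell_codeStream (D : ℕ) (ω : ℕ → Fin n → Fin k) (t : ℕ) (i : Fin n) :
    denCell D k (parentNums G) (codeStream ω t) i = i * D + parentCode G i (ω t) := by
  rw [denCell, parentNums_val, List.map_map, parentCode]
  congr 3
  funext j
  exact codeStream_val ω t j

/-- Each sample increments one denominator cell per vertex, and vertex j stays within its own block
of k ^ d cells, so only j = i can hit the given cell. -/
theorem sum_denCell (hk : 2 ≤ k) {d : ℕ} (hd : ∀ i, (parents G i).card ≤ d)
    (ω : ℕ → Fin n → Fin k) (m : ℕ) (i : Fin n) {a : ℕ} (ha : a < k ^ d) :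
    (∑ t ∈ Finset.range m, ∑ j ∈ Finset.range n,
      if denCell (k ^ d) k (parentNums G) (codeStream ω t) j = i * k ^ d + a then 1 else 0) =
      count (ParentEvent G i a) m ω := by
  classical
  refine Finset.sum_congr rfl fun t _ => ?_
  rw [← Fin.sum_univ_eq_sum_range (fun j =>
    if denCell (k ^ d) k (parentNums G) (codeStream ω t) j = i * k ^ d + a then 1 else 0) n,
    Finset.sum_eq_single_of_mem i (Finset.mem_univ i)]
  · refine if_congr ?_ rfl rfl
    rw [denCell_codeStream, mul_add_eq_mul_add_iff (parentCode_lt hk (hd i) _) ha]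
    exact and_iff_right rfl
  · intro j _ hj
    rw [denCell_codeStream, if_neg]
    rw [mul_add_eq_mul_add_iff (parentCode_lt hk (hd j) _) ha]
    exact fun h => hj (Fin.ext h.1)

theorem sum_numCell (hk : 2 ≤ k) {d : ℕ} (hd : ∀ i, (parents G i).card ≤ d)
    (ω : ℕ → Fin n → Fin k) (m : ℕ) (i : Fin n) {a : ℕ} (ha : a < k ^ d) (σ : Fin k) :
    (∑ t ∈ Finset.range m, ∑ j ∈ Finset.range n,
      if numCell (k ^ d) k (parentNums G) (codeStream ω t) j = (i * k ^ d + a) * k + σ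
        then 1 else 0) = count (FamilyEvent G i a σ) m ω := by
  classical
  have key : ∀ t (j : Fin n), numCell (k ^ d) k (parentNums G) (codeStream ω t) j =
      (i * k ^ d + a) * k + σ ↔ (j = i ∧ parentCode G j (ω t) = a) ∧ ω t j = σ := fun t j => by
    rw [numCell, codeStream_val, denCell_codeStream,
      mul_add_eq_mul_add_iff (ω t j).isLt σ.isLt,
      mul_add_eq_mul_add_iff (parentCode_lt hk (hd j) _) ha, Fin.ext_iff, Fin.ext_iff]
  refine Finset.sum_congr rfl fun t _ => ?_
  rw [← Fin.sum_univ_eq_sum_range (fun j =>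
    if numCell (k ^ d) k (parentNums G) (codeStream ω t) j = (i * k ^ d + a) * k + σ
      then 1 else 0) n, Finset.sum_eq_single_of_mem i (Finset.mem_univ i)]
  · refine if_congr ?_ rfl rfl
    rw [key, FamilyEvent]
    simp
  · intro j _ hj
    rw [if_neg]
    rw [key]
    exact fun h => hj h.1.1

theorem exists_exec_learnProg (hG : IsDAG G) (hk : 2 ≤ k) {d : ℕ}
    (hd : ∀ i, (parents G i).card ≤ d) {e f : ℚ} {A N L : ℕ} (he : 0 < e.num.toNat)
    (hf : 0 < f.num.toNat) (hA : A = invCeil e.num.toNat e.den) (hN : N = k ^ d * n * k)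
    (hL : L = logCeil f.num.toNat (f.den * (N + N + (N + N)))) (hL0 : 0 < L)
    (ω : ℕ → Fin n → Fin k) {Q : PMF (Fin n → Fin k)}
    (hQ : ∀ x, (Q x).toReal = ∏ i, estFactor G L (sampleSize N L A) ω i x) :
    ∃ s T, Exec (codeStream ω) learnProg (initConfig k d G e f) s T ∧ s.draws = sampleSize N L A ∧
      T ≤ 8 * A + 4 * A * A + d * (4 * k + 8) + 4 * n + 8 * k + 16 * N + 8 * L + 1400
        + (4 * (k ^ d * n) + 4 * N + 5
        + (sampleSize N L A * (n * (d * (4 * k + 11) + 4 * k + 23) + 9) + 3 + 1)) ∧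
      Encodes d G s Q ∧ IsBayesNet G Q := by
  have hlen : ∀ i (hi : i < n), (parentNums G i).length = (parentList G ⟨i, hi⟩).length :=
    fun i hi => by rw [parentNums, dif_pos hi, List.length_map]
  have hle : ∀ i < n, (parentNums G i).length ≤ d := fun i hi => by
    rw [hlen i hi, parentList_length]
    exact hd _
  obtain ⟨s, T, hex, hT, h3, h2, hdr⟩ := runs_learnProg (s := initConfig k d G e f)
    (ω := codeStream ω) (n := n) (k := k) (d := d) (l := parentNums G) he hf rfl rfl rfl rfl rfl
    rfl rfl hA hN hL hle
    (fun i hi => by simp [initConfig, hi, hlen i hi])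
    (fun i hi j hj => by
      have hjd : j < d := hj.trans_le (hle i hi)
      have e1 : (i * d + j) / d = i := by
        rw [add_comm, Nat.add_mul_div_right _ _ (by omega), Nat.div_eq_of_lt hjd, zero_add]
      have e2 : (i * d + j) % d = j := by rw [Nat.mul_add_mod', Nat.mod_eq_of_lt hjd]
      have hj' : j < (parentList G ⟨i, hi⟩).length := hlen i hi ▸ hj
      simp [initConfig, e1, e2, hi, hj', parentNums]) rfl
  have hden : ∀ (i : Fin n) (a : ℕ), a < k ^ d →
      outDen k d s i a = estDen G L (sampleSize N L A) ω i a := fun i a ha => by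
    rw [outDen, h3, sum_denCell hk hd ω _ i ha, estDen, mul_right_comm]
    calc (i : ℕ) * k ^ d + a < (i + 1) * k ^ d := by rw [add_mul]; omega
      _ ≤ k ^ d * n := by rw [mul_comm]; exact Nat.mul_le_mul_left _ i.isLt
  have hnum : ∀ (i : Fin n) (a : ℕ) (σ : Fin k), a < k ^ d →
      outNum k d s i a σ = estNum G L (sampleSize N L A) ω i a σ := fun i a σ ha => by
    rw [outNum, h2, sum_numCell hk hd ω _ i ha, estNum]
    have h1 : (i : ℕ) * k ^ d + a + 1 ≤ k ^ d * n := by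
      calc (i : ℕ) * k ^ d + a + 1 ≤ (i + 1) * k ^ d := by rw [add_mul]; omega
        _ ≤ k ^ d * n := by rw [mul_comm]; exact Nat.mul_le_mul_left _ i.isLt
    calc ((i : ℕ) * k ^ d + a) * k + σ < ((i : ℕ) * k ^ d + a + 1) * k := by
          rw [add_mul _ 1]; have := σ.isLt; omega
      _ ≤ N := by rw [hN]; exact Nat.mul_le_mul_right _ h1
  refine ⟨s, T, hex, hdr, hT, ⟨fun i x => ?_, fun x => ?_⟩,
    isBayesNet_of_factor hG (by omega) (isLocalFactor_estFactor hG (by omega) hL0 _ ω) hQ⟩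
  · have hc := parentCode_lt hk (hd i) x
    simp only [hden i _ hc, hnum i _ _ hc]
    exact ⟨estDen_pos (by omega) hL0 _ ω i _, sum_estNum G L _ ω i _⟩
  · rw [hQ]
    refine Finset.prod_congr rfl fun i _ => ?_
    have hc := parentCode_lt hk (hd i) x
    rw [hden i _ hc, hnum i _ _ hc, estFactor]

/-! ### Sample size and running time -/

theorem cast_num_toNat {e : ℚ} (he : (0 : ℝ) < e) :
    0 < e.num.toNat ∧ (e : ℝ) * e.den = e.num.toNat := by
  have he' : 0 < e := by exact_mod_cast he
  have hn := Rat.num_pos.2 he'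
  refine ⟨by omega, ?_⟩
  have h1 : ((e.num.toNat : ℕ) : ℤ) = e.num := Int.toNat_of_nonneg hn.le
  have h2 : ((e.num.toNat : ℕ) : ℝ) = (e.num : ℝ) := by exact_mod_cast congrArg (Int.cast (R := ℝ)) h1
  rw [h2]
  exact_mod_cast Rat.mul_den_eq_num e

/-- The invariant of the ceiling A of 1/e is (A - 1)e < 1 ≤ Ae. So Ae ≤ 1 + e ≤ 2, and ε ≤ 2e
doubles this to 4. -/
theorem invCeil_bounds {e ε : ℝ} {p q : ℕ} (hp : 0 < p) (hq : 0 < q) (hpq : e * q = p)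
    (hε : ε / 2 ≤ e) (he : e ≤ 1) :
    1 ≤ invCeil p q ∧ 1 ≤ invCeil p q * e ∧ invCeil p q * ε ≤ 4 := by
  have hq' : (0 : ℝ) < q := Nat.cast_pos.2 hq
  have h1 := le_invCeil_mul hp q
  have hA : 1 ≤ invCeil p q := by
    by_contra! h
    have : invCeil p q = 0 := by omega
    rw [this] at h1
    omega
  have h2 := mul_lt_of_lt_invCeil (p := p) (q := q) (j := invCeil p q - 1) (by omega)
  have h1' : (q : ℝ) ≤ invCeil p q * p := by exact_mod_cast h1
  have h2' : ((invCeil p q : ℝ) - 1) * p < q := by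
    have : (((invCeil p q - 1 : ℕ) : ℝ)) * p < q := by exact_mod_cast h2
    rwa [Nat.cast_sub hA, Nat.cast_one] at this
  rw [← hpq] at h1' h2'
  have h3 : 1 ≤ invCeil p q * e := by
    refine le_of_mul_le_mul_right ?_ hq'
    linarith
  have h4 : ((invCeil p q : ℝ) - 1) * e < 1 := by
    refine lt_of_mul_lt_mul_right ?_ hq'.le
    linarith
  refine ⟨hA, h3, ?_⟩
  have hA' : (1 : ℝ) ≤ invCeil p q := by exact_mod_cast hA
  nlinarith

theorem logCeil_bounds {f δ : ℝ} {p q N : ℕ} (hp : 0 < p) (hq : 0 < q) (hpq : f * q = p)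
    (hδ : δ / 2 ≤ f) (hδ0 : 0 < δ) (hfδ : f ≤ δ) (hδ1 : δ < 1) (hN : 2 ≤ N) :
    1 ≤ logCeil p (q * (N + N + (N + N))) ∧
      4 * N * Real.exp (-(logCeil p (q * (N + N + (N + N))) : ℕ)) ≤ f ∧
      (logCeil p (q * (N + N + (N + N))) : ℝ) ≤ 11 * (Real.log N * Real.log (2 / δ)) := by
  set L := logCeil p (q * (N + N + (N + N))) with hL
  have hq' : (0 : ℝ) < q := Nat.cast_pos.2 hq
  have hN' : (2 : ℝ) ≤ N := by exact_mod_cast hN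
  have h1 := le_mul_two_pow_logCeil hp (q * (N + N + (N + N)))
  rw [← hL] at h1
  have h1' : (q : ℝ) * (4 * N) ≤ p * 2 ^ L := by
    have : ((q * (N + N + (N + N)) : ℕ) : ℝ) ≤ ((p * 2 ^ L : ℕ) : ℝ) := by exact_mod_cast h1
    push_cast at this
    linarith
  rw [← hpq] at h1'
  have h3 : 4 * (N : ℝ) ≤ f * 2 ^ L := by
    refine le_of_mul_le_mul_left ?_ hq'
    linarith
  have hL1 : 1 ≤ L := by
    by_contra! h
    have : L = 0 := by omega
    rw [this] at h3
    norm_num at h3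
    linarith
  have h2 := mul_two_pow_lt_of_lt_logCeil (p := p) (q := q * (N + N + (N + N))) (j := L - 1)
    (by omega)
  have h2' : p * (2 : ℝ) ^ (L - 1) < q * (4 * N) := by
    have : ((p * 2 ^ (L - 1) : ℕ) : ℝ) < ((q * (N + N + (N + N)) : ℕ) : ℝ) := by exact_mod_cast h2
    push_cast at this
    linarith
  rw [← hpq] at h2'
  have h4 : f * (2 : ℝ) ^ (L - 1) < 4 * N := by
    refine lt_of_mul_lt_mul_left ?_ hq'.le
    linarith
  have hf0 : 0 < f := by linarith
  refine ⟨hL1, ?_, ?_⟩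
  -- The loop works with powers of 2, the tail bound with powers of the larger number exp 1.
  · rw [Real.exp_neg, ← div_eq_mul_inv, div_le_iff₀ (Real.exp_pos _)]
    refine h3.trans (mul_le_mul_of_nonneg_left ?_ hf0.le)
    have : Real.exp (L : ℝ) = Real.exp 1 ^ L := by rw [← Real.exp_nat_mul, mul_one]
    rw [this]
    gcongr
    have := Real.add_one_le_exp (1 : ℝ)
    linarith
  · set c := Real.log 2
    have hc : 0.69 < c := by have := Real.log_two_gt_d9; linarith
    set x := Real.log N
    set y := Real.log (2 / δ)
    have hx : c ≤ x := Real.log_le_log (by norm_num) hN'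
    have hy : c ≤ y := Real.log_le_log (by norm_num) (by
      rw [le_div_iff₀ hδ0]
      linarith)
    have h5 : (2 : ℝ) ^ L ≤ 2 ^ 3 * (N * (2 / δ)) := by
      have e1 : (2 : ℝ) ^ L = 2 * 2 ^ (L - 1) := by
        rw [← pow_succ']
        congr 1
        omega
      have h6 : δ / 2 * (2 : ℝ) ^ (L - 1) ≤ 4 * N :=
        (mul_le_mul_of_nonneg_right hδ (by positivity)).trans h4.le
      rw [e1, mul_div_assoc', mul_div_assoc', le_div_iff₀ hδ0]
      linarith
    have h6 := Real.log_le_log (by positivity) h5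
    rw [Real.log_pow, Real.log_mul (by norm_num) (by positivity), Real.log_pow,
      Real.log_mul (by positivity) (by positivity)] at h6
    have h7 : L * c ≤ 3 * c + (x + y) := by exact_mod_cast h6
    -- Both logarithms are at least c = log 2, so 3c² + cx + cy ≤ 5xy: here the sum of logarithms
    -- becomes a product. The constant 11 exceeds 5/0.476.
    have h8 : L * c ^ 2 ≤ 5 * (x * y) := by
      nlinarith [mul_nonneg (sub_nonneg.2 hx) (sub_nonneg.2 hy)]
    have h9 : 0 ≤ x * y := mul_nonneg (by linarith) (by linarith)
    have h10 : (0.476 : ℝ) ≤ c ^ 2 := by nlinarith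
    have h11 : (L : ℝ) * 0.476 ≤ L * c ^ 2 := mul_le_mul_of_nonneg_left h10 (Nat.cast_nonneg L)
    linarith

/-- The constants multiply to 312 · 11 · 16 = 54912, rounded up to 60000. -/
theorem sampleSize_le {N L A : ℕ} {ε x : ℝ} (hε : 0 < ε) (hA : A * ε ≤ 4) (hL : L ≤ 11 * x) :
    (sampleSize N L A : ℝ) ≤ 60000 * (N * x * (ε ^ 2)⁻¹) := by
  have h1 : (A : ℝ) ^ 2 ≤ 16 * (ε ^ 2)⁻¹ := by
    rw [← div_eq_mul_inv, le_div_iff₀ (by positivity), ← mul_pow]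
    calc (A * ε) ^ 2 ≤ 4 ^ 2 := pow_le_pow_left₀ (by positivity) hA 2
      _ = 16 := by norm_num
  have hx : 0 ≤ x := by have : (0 : ℝ) ≤ L := Nat.cast_nonneg L; linarith
  calc (sampleSize N L A : ℝ) = 312 * N * (L * (A : ℝ) ^ 2) := by
        simp only [sampleSize, Nat.cast_mul, Nat.cast_ofNat]; ring
    _ ≤ 312 * N * (11 * x * (16 * (ε ^ 2)⁻¹)) := by gcongr
    _ = 54912 * (N * x * (ε ^ 2)⁻¹) := by ring
    _ ≤ 60000 * (N * x * (ε ^ 2)⁻¹) := by gcongr; norm_num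

/-- The term m n (dk + 1) dominates, and dk ≤ k^(d+1) because d < k^d. The preprocessing is absorbed
because m is at least N, L and A². -/
theorem steps_le {n k d N L A : ℕ} (hn : 1 ≤ n) (hk : 2 ≤ k) (hN : N = k ^ d * n * k) (hL : 1 ≤ L)
    (hA : 1 ≤ A) :
    8 * A + 4 * A * A + d * (4 * k + 8) + 4 * n + 8 * k + 16 * N + 8 * L + 1400
      + (4 * (k ^ d * n) + 4 * N + 5
      + (sampleSize N L A * (n * (d * (4 * k + 11) + 4 * k + 23) + 9) + 3 + 1)) ≤
      60000 * (k ^ (d + 1) * sampleSize N L A * n) := by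
  set m := sampleSize N L A with hm
  have hkd : 1 ≤ k ^ d := Nat.one_le_pow _ _ (by omega)
  have hkdn : 1 ≤ k ^ d * n := Nat.mul_pos hkd hn
  have hN1 : 1 ≤ N := hN ▸ Nat.mul_pos hkdn (by omega)
  have hm1 : N * L * (A * A) ≤ m := Nat.le_mul_of_pos_right _ (by norm_num)
  have hAA : 1 ≤ A * A := Nat.mul_pos hA hA
  have hNL : 1 ≤ N * L := Nat.mul_pos hN1 hL
  have mA2 : A * A ≤ m := (Nat.le_mul_of_pos_left _ hNL).trans hm1
  have mA : A ≤ m := (Nat.le_mul_of_pos_left _ hA).trans mA2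
  have mNL : N * L ≤ m := (Nat.le_mul_of_pos_right _ hAA).trans hm1
  have mN : N ≤ m := (Nat.le_mul_of_pos_right _ hL).trans mNL
  have mL : L ≤ m := (Nat.le_mul_of_pos_left _ hN1).trans mNL
  have Nk : k ≤ N := hN ▸ Nat.le_mul_of_pos_left _ hkdn
  have Nkn : k ^ d * n ≤ N := hN ▸ Nat.le_mul_of_pos_right _ (by omega)
  have Nn : n ≤ N := (Nat.le_mul_of_pos_left _ hkd).trans Nkn
  set W := k ^ (d + 1) with hW
  have hdk : d * k ≤ W := by
    rw [hW, pow_succ]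
    exact Nat.mul_le_mul_right _ (Nat.lt_pow_self (by omega)).le
  have hkW : k ≤ W := by
    rw [hW, pow_succ]
    exact Nat.le_mul_of_pos_left _ hkd
  have hdW : d ≤ W := (Nat.le_mul_of_pos_right d (by omega)).trans hdk
  have hW1 : 1 ≤ W := by omega
  have hmX : m ≤ W * m * n := by
    rw [mul_assoc]
    exact (Nat.le_mul_of_pos_right _ hn).trans (Nat.le_mul_of_pos_left _ hW1)
  have hWX : W ≤ W * m * n := by
    rw [mul_assoc]
    exact Nat.le_mul_of_pos_right _ (Nat.mul_pos (by omega) hn)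
  have hvertex : d * (4 * k + 11) + 4 * k + 23 ≤ 42 * W := by
    have : d * (4 * k + 11) = 4 * (d * k) + 11 * d := by ring
    omega
  have hsample : m * (n * (d * (4 * k + 11) + 4 * k + 23) + 9) ≤ 51 * (W * m * n) := by
    calc m * (n * (d * (4 * k + 11) + 4 * k + 23) + 9) ≤ m * (n * (42 * W) + 9) := by gcongr
      _ = 42 * (W * m * n) + 9 * m := by ring
      _ ≤ _ := by omega
  have hpow : d * (4 * k + 8) = 4 * (d * k) + 8 * d := by ring
  have hsq : 4 * A * A = 4 * (A * A) := by ring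
  rw [hpow, hsq]
  omega

end

end BayesLearn

/-! ### Assembly of the learning theorem -/

theorem theorem4p2 :
    ∃ (prog : BayesLearn.Prog) (C : ℝ), 0 < C ∧
      ∀ (n k d : ℕ) (G : Digraph (Fin n)), 1 ≤ n → 2 ≤ k → BayesLearn.IsDAG G →
        (∀ i, (BayesLearn.parents G i).card ≤ d) →
      ∀ (ε δ : ℝ), 0 < ε → ε ≤ 1 → 0 < δ → δ < 1 →
      ∀ (e f : ℚ), ε / 2 ≤ (e : ℝ) → (e : ℝ) ≤ ε → δ / 2 ≤ (f : ℝ) → (f : ℝ) ≤ δ →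
        ∃ (m : ℕ) (Q : (ℕ → Fin n → Fin k) → PMF (Fin n → Fin k)),
          (m : ℝ) ≤ C * ((k : ℝ) ^ (d + 1) * n * Real.log ((k : ℝ) ^ (d + 1) * n)
            * (ε ^ 2)⁻¹ * Real.log (2 / δ)) ∧
          (∀ ω : ℕ → Fin n → Fin k,
            ∃ (s : BayesLearn.Config) (T : ℕ),
              BayesLearn.Exec (BayesLearn.codeStream ω) prog
                (BayesLearn.initConfig k d G e f) s T ∧
              s.draws = m ∧
              (T : ℝ) ≤ C * ((k : ℝ) ^ (d + 1) * m * n) ∧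
              BayesLearn.Encodes d G s (Q ω) ∧
              BayesLearn.IsBayesNet G (Q ω)) ∧
          ∀ P : PMF (Fin n → Fin k), BayesLearn.IsBayesNet G P →
            BayesLearn.sampleLaw P {ω | ¬ BayesLearn.tvDist P (Q ω) ≤ ε} ≤ ENNReal.ofReal δ := by
  refine ⟨BayesLearn.learnProg, 60000, by norm_num, ?_⟩
  intro n k d G hn hk hG hd ε δ hε hε1 hδ hδ1 e f he heε hf hfδ
  obtain ⟨hp, hpq⟩ := BayesLearn.cast_num_toNat (e := e) (by linarith)
  obtain ⟨hp', hpq'⟩ := BayesLearn.cast_num_toNat (e := f) (by linarith)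
  obtain ⟨hA, hAe, hAε⟩ := BayesLearn.invCeil_bounds hp e.den_pos hpq he (by linarith)
  set A := BayesLearn.invCeil e.num.toNat e.den with hAdef
  obtain ⟨N, hN⟩ : ∃ N, N = k ^ d * n * k := ⟨_, rfl⟩
  have hN2 : 2 ≤ N := hN ▸ hk.trans (Nat.le_mul_of_pos_left _
    (Nat.mul_pos (Nat.pow_pos (by omega)) hn))
  have hNcast : (k : ℝ) ^ (d + 1) * n = N := by
    rw [hN]
    push_cast
    ring
  obtain ⟨hL, hLf, hLlog⟩ := BayesLearn.logCeil_bounds hp' f.den_pos hpq' hf hδ hfδ hδ1 hN2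
  set L := BayesLearn.logCeil f.num.toNat (f.den * (N + N + (N + N))) with hLdef
  set m := BayesLearn.sampleSize N L A with hm
  have hm0 : 0 < m := by
    rw [hm, BayesLearn.sampleSize]
    positivity
  -- Smoothing gives a valid network for every sample sequence, including those in which some parent
  -- assignment never occurs.
  choose Q hQ using fun ω : ℕ → Fin n → Fin k =>
    BayesLearn.exists_pmf_of_factor hG (by omega)
      (BayesLearn.isLocalFactor_estFactor (k := k) hG (L := L) (by omega) hL m ω)
      fun i x => (BayesLearn.estFactor_pos (by omega) hL m ω i x).le
  refine ⟨m, Q, ?_, fun ω => ?_, fun P hP => ?_⟩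
  · rw [hNcast]
    refine (BayesLearn.sampleSize_le hε hAε hLlog).trans (le_of_eq ?_)
    ring
  · obtain ⟨s, T, hex, hdr, hT, henc, hbn⟩ :=
      BayesLearn.exists_exec_learnProg hG hk hd hp hp' hAdef hN hLdef hL ω (hQ ω)
    refine ⟨s, T, hex, hdr, ?_, henc, hbn⟩
    exact_mod_cast hT.trans (BayesLearn.steps_le hn hk hN hL hA)
  · have hsub : {ω | ¬ BayesLearn.tvDist P (Q ω) ≤ ε} ⊆
        {ω | ¬ BayesLearn.AllClose G d L m P ω} := by
      intro ω hω hc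
      refine hω (le_trans (le_abs_self _) (abs_le_of_sq_le_sq ?_ hε.le))
      refine (hc.tvDist_sq_le hG hk hL hm0 hd hP (hQ ω)).trans ?_
      have hA0 : (0 : ℝ) < A := Nat.cast_pos.2 hA
      have hL0 : (0 : ℝ) < L := Nat.cast_pos.2 hL
      have hN0 : (0 : ℝ) < N := Nat.cast_pos.2 (by omega)
      have h1 : 1 ≤ A * ε := hAe.trans (mul_le_mul_of_nonneg_left heε hA0.le)
      -- The sample size is chosen to make the squared-distance bound exactly A⁻², and 1 ≤ Ae ≤ Aε.
      have h2 : 312 * ((k : ℝ) ^ (d + 1) * n * L) / m = 1 / (A : ℝ) ^ 2 := by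
        rw [hNcast, hm, BayesLearn.sampleSize]
        push_cast
        field_simp
      rw [h2, div_le_iff₀ (by positivity), ← mul_pow, mul_comm]
      exact one_le_pow₀ h1
    have : IsProbabilityMeasure (BayesLearn.sampleLaw P) := by
      unfold BayesLearn.sampleLaw
      infer_instance
    -- Monotonicity holds for arbitrary sets, so measurability of the failure event is not needed.
    refine (measure_mono hsub).trans ?_
    rw [← ofReal_measureReal]
    refine ENNReal.ofReal_le_ofReal ((BayesLearn.sampleLaw_not_allClose_le G d
      (by omega) hL m P).trans ?_)
    rw [hNcast]
    exact hLf.trans hfδ
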